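/- Let $\ell$ be a prime number, let $n\ge 1$, and let $F$ be a field of characteristic different from $\ell$ that has no nontrivial finite extensions of degree prime to $\ell$. For a field $K$ let $k_m(K)=K^{\mathrm M}_m(K)/\ell K^{\mathrm M}_m(K)$ denote the Milnor K-groups of $K$ modulo $\ell$. Assume that for all finite field extensions $F\subseteq K\subseteq L$ with $[L:K]=\ell$ the sequence $$k_n(K)\xrightarrow{\ i\ }k_n(L)_\Sigma\xrightarrow{\ \mathrm{tr}\ }k_n(K)\xrightarrow{\ u\cdot\ }k_{n+1}(K)$$ is exact at its two middle terms. Here $\Sigma=\mathrm{Gal}(L/K)$, $k_n(L)_\Sigma$ is the group of coinvariants, $i$ is induced by the inclusion $K\subseteq L$, and $\mathrm{tr}$ is induced by the transfer homomorphism $\mathrm{tr}_{L/K}\colon k_n(L)\to k_n(K)$, which is determined by $\mathrm{tr}_{L/K}\{a_1,\dots,b,\dots,a_n\}=\{a_1,\dots,N_{L/K}(b),\dots,a_n\}$ for $a_i\in K^\times$ and $b\in L^\times$. Moreover $u\in k_1(K)=K^\times/K^{\times\ell}$ is the class corresponding to the cyclic extension $L/K$, that is, $u=\{a\}$ with $L=K(\sqrt[\ell]{a})$;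 it is unique up to a factor in $(\mathbb Z/\ell)^\times$, on which exactness does not depend. Assume further that $k_{n+1}(F)=0$. Then $k_{n+1}(E)=0$ for every finite field extension $E/F$. -/

import Mathlib

open scoped TensorProduct

universe u

noncomputable section

/-- The pure tensor `a₁ ⊗ ⋯ ⊗ aₙ` in the `n`-th tensor power over `ℤ` of the multiplicative
group of a field (written additively). -/
def unitTensor {F : Type u} [Field F] {n : ℕ} (a : Fin n → Fˣ) : ⨂[ℤ]^n (Additive Fˣ) :=
  PiTensorProduct.tprod ℤ fun i => Additive.ofMul (a i)

/-- The Steinberg relations in degree `n`: the degree `n` part of the two-sided ideal of the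
tensor algebra of `Fˣ` generated by the tensors `a ⊗ (1 - a)`. -/
def steinbergRelations (F : Type u) [Field F] (n : ℕ) : Submodule ℤ (⨂[ℤ]^n (Additive Fˣ)) :=
  Submodule.span ℤ {t | ∃ a : Fin n → Fˣ,
    (∃ i j : Fin n, j.val = i.val + 1 ∧ (a i : F) + (a j : F) = 1) ∧ t = unitTensor a}

/-- The Milnor K-group `K^M_n(F)`. -/
abbrev MilnorK (F : Type u) [Field F] (n : ℕ) : Type u :=
  (⨂[ℤ]^n (Additive Fˣ)) ⧸ steinbergRelations F n

/-- The Milnor K-group modulo `ℓ`, `k_n(F) = K^M_n(F) / ℓ K^M_n(F)`. -/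
abbrev MilnorKMod (ℓ : ℕ) (F : Type u) [Field F] (n : ℕ) : Type u :=
  MilnorK F n ⧸ LinearMap.range (LinearMap.lsmul ℤ (MilnorK F n) (ℓ : ℤ))

namespace MilnorKMod

/-- The class in `k_n(F)` of the symbol `{a₁, …, aₙ}`. -/
def symbol (ℓ : ℕ) {F : Type u} [Field F] {n : ℕ} (a : Fin n → Fˣ) : MilnorKMod ℓ F n :=
  Submodule.Quotient.mk (Submodule.Quotient.mk (unitTensor a))

/-- A linear map of Milnor K-groups induces one modulo `ℓ`. -/
def reduce (ℓ : ℕ) {F F' : Type u} [Field F] [Field F'] {n m : ℕ}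
    (f : MilnorK F n →ₗ[ℤ] MilnorK F' m) : MilnorKMod ℓ F n →ₗ[ℤ] MilnorKMod ℓ F' m :=
  Submodule.mapQ _ _ f (by
    rintro _ ⟨x, rfl⟩
    exact ⟨f x, by simp⟩)

/-- The tensor power of the homomorphism `Fˣ → F'ˣ` induced by a field homomorphism. -/
def tensorMap {F F' : Type u} [Field F] [Field F'] (f : F →+* F') (n : ℕ) :
    (⨂[ℤ]^n (Additive Fˣ)) →ₗ[ℤ] (⨂[ℤ]^n (Additive F'ˣ)) :=
  PiTensorProduct.map fun _ => (MonoidHom.toAdditive (Units.map (f : F →* F'))).toIntLinearMap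

lemma tensorMap_unitTensor {F F' : Type u} [Field F] [Field F'] (f : F →+* F') {n : ℕ}
    (a : Fin n → Fˣ) :
    tensorMap f n (unitTensor a) = unitTensor fun i => Units.map (f : F →* F') (a i) := by
  simp only [tensorMap, unitTensor, PiTensorProduct.map_tprod]
  rfl

/-- The homomorphism `k_n(F) → k_n(F')`, `{a₁, …, aₙ} ↦ {f a₁, …, f aₙ}`, induced by a field
homomorphism `f : F → F'`. -/
def map (ℓ n : ℕ) {F F' : Type u} [Field F] [Field F'] (f : F →+* F') :
    MilnorKMod ℓ F n →ₗ[ℤ] MilnorKMod ℓ F' n :=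
  reduce ℓ (Submodule.mapQ _ _ (tensorMap f n) (by
    refine Submodule.span_le.2 ?_
    rintro _ ⟨a, ⟨i, j, hij, h⟩, rfl⟩
    refine Submodule.subset_span ⟨_, ⟨i, j, hij, ?_⟩, tensorMap_unitTensor f a⟩
    simpa using congrArg f h))

lemma map_symbol (ℓ : ℕ) {n : ℕ} {F F' : Type u} [Field F] [Field F'] (f : F →+* F')
    (a : Fin n → Fˣ) :
    map ℓ n f (symbol ℓ a) = symbol ℓ fun i => Units.map (f : F →* F') (a i) := by
  simp only [symbol, ← tensorMap_unitTensor]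
  rfl

lemma hom_ext {ℓ n : ℕ} {F : Type u} [Field F] {A : Type*} [AddCommGroup A]
    {f g : MilnorKMod ℓ F n →ₗ[ℤ] A} (h : ∀ a : Fin n → Fˣ, f (symbol ℓ a) = g (symbol ℓ a)) :
    f = g := by
  refine Submodule.linearMap_qext _ (Submodule.linearMap_qext _ (PiTensorProduct.ext ?_))
  ext a
  exact h fun i => (a i).toMul

/-- Left multiplication by `a`, `a₁ ⊗ ⋯ ⊗ aₙ ↦ a ⊗ a₁ ⊗ ⋯ ⊗ aₙ`. -/
def tensorCons {F : Type u} [Field F] (a : Fˣ) (n : ℕ) :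
    (⨂[ℤ]^n (Additive Fˣ)) →ₗ[ℤ] (⨂[ℤ]^(n + 1) (Additive Fˣ)) :=
  PiTensorProduct.lift
    ((PiTensorProduct.tprod ℤ (s := fun _ : Fin (n + 1) => Additive Fˣ)).curryLeft
      (Additive.ofMul a))

lemma tensorCons_unitTensor {F : Type u} [Field F] (a : Fˣ) {n : ℕ} (b : Fin n → Fˣ) :
    tensorCons a n (unitTensor b) = unitTensor (Fin.cons a b : Fin (n + 1) → Fˣ) := by
  simp only [tensorCons, unitTensor, PiTensorProduct.lift.tprod, MultilinearMap.curryLeft_apply]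
  congr 1

/-- Multiplication by the class `{a} ∈ k_1(F)`, as a homomorphism `k_n(F) → k_{n+1}(F)`,
`{a₁, …, aₙ} ↦ {a, a₁, …, aₙ}`. -/
def unitMul (ℓ n : ℕ) {F : Type u} [Field F] (a : Fˣ) :
    MilnorKMod ℓ F n →ₗ[ℤ] MilnorKMod ℓ F (n + 1) :=
  reduce ℓ (Submodule.mapQ _ _ (tensorCons a n) (by
    refine Submodule.span_le.2 ?_
    rintro _ ⟨b, ⟨i, j, hij, h⟩, rfl⟩
    refine Submodule.subset_span ⟨_, ⟨i.succ, j.succ, ?_, ?_⟩, tensorCons_unitTensor a b⟩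
    · simp [hij]
    · simpa using h))

lemma unitMul_symbol (ℓ : ℕ) {n : ℕ} {F : Type u} [Field F] (a : Fˣ) (b : Fin n → Fˣ) :
    unitMul ℓ n a (symbol ℓ b) = symbol ℓ (Fin.cons a b : Fin (n + 1) → Fˣ) := by
  simp only [symbol, ← tensorCons_unitTensor]
  rfl

section Extension

variable (ℓ n : ℕ) (K L : Type u) [Field K] [Field L] [Algebra K L]

/-- The inclusion homomorphism `i_{L/K} : k_n(K) → k_n(L)`. -/
def incl : MilnorKMod ℓ K n →ₗ[ℤ] MilnorKMod ℓ L n :=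
  map ℓ n (algebraMap K L)

/-- The natural action of `Σ = Gal(L/K)` on `k_n(L)`. -/
def galoisRep : Representation ℤ (L ≃ₐ[K] L) (MilnorKMod ℓ L n) where
  toFun σ := map ℓ n (σ : L →+* L)
  map_one' := by
    refine hom_ext fun a => ?_
    rw [map_symbol]
    exact congrArg (symbol ℓ) (funext fun i => Units.ext rfl)
  map_mul' σ τ := by
    refine hom_ext fun a => ?_
    rw [Module.End.mul_apply, map_symbol, map_symbol, map_symbol]
    exact congrArg (symbol ℓ) (funext fun i => Units.ext rfl)

/-- The coinvariants `k_n(L)_Σ`, `Σ = Gal(L/K)`. -/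
abbrev GaloisCoinvariants : Type u := (galoisRep ℓ n K L).Coinvariants

/-- The inclusion of `Kˣ` into `Lˣ`. -/
abbrev unitIncl : Kˣ →* Lˣ := Units.map (algebraMap K L : K →* L)

/-- The norm `N_{L/K} : Lˣ → Kˣ`. -/
abbrev unitNorm : Lˣ →* Kˣ := Units.map (Algebra.norm K : L →* K)

/-- `T : k_n(L) → k_n(K)` is the transfer: it satisfies the projection formulas
`T {a₁, …, aₙ} = [L : K] {a₁, …, aₙ}` and
`T {a₁, …, b, …, aₙ} = {a₁, …, N_{L/K} b, …, aₙ}` for `aᵢ ∈ Kˣ`, `b ∈ Lˣ`, and it is invariant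
under `Gal(L/K)`. If `[L : K] = ℓ` and `K` has no nontrivial finite extensions of degree prime
to `ℓ`, then the symbols `{a₁, …, b, …, aₙ}` generate `k_n(L)` for `n ≥ 1`, so that these
formulas determine `T`, and the transfer of Bass and Tate satisfies them. -/
structure IsTransfer (T : MilnorKMod ℓ L n →ₗ[ℤ] MilnorKMod ℓ K n) : Prop where
  symbol_incl : ∀ a : Fin n → Kˣ,
    T (symbol ℓ fun i => unitIncl K L (a i)) = (Module.finrank K L : ℤ) • symbol ℓ a
  symbol_update : ∀ (a : Fin n → Kˣ) (j : Fin n) (b : Lˣ),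
    T (symbol ℓ (Function.update (fun i => unitIncl K L (a i)) j b)) =
      symbol ℓ (Function.update a j (unitNorm K L b))
  galois_invariant : ∀ σ : L ≃ₐ[K] L, T ∘ₗ galoisRep ℓ n K L σ = T

open Classical in
/-- The transfer homomorphism `tr_{L/K} : k_n(L) → k_n(K)` (by convention `0` where there is no
such homomorphism). -/
def transfer : MilnorKMod ℓ L n →ₗ[ℤ] MilnorKMod ℓ K n :=
  if h : ∃ T, IsTransfer ℓ n K L T then h.choose else 0

lemma transfer_galois (σ : L ≃ₐ[K] L) :
    transfer ℓ n K L ∘ₗ galoisRep ℓ n K L σ = transfer ℓ n K L := by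
  unfold transfer
  split_ifs with h
  · exact h.choose_spec.galois_invariant σ
  · exact LinearMap.zero_comp _

/-- The map `i : k_n(K) → k_n(L)_Σ`. -/
def inclCoinv : MilnorKMod ℓ K n →ₗ[ℤ] GaloisCoinvariants ℓ n K L :=
  Representation.Coinvariants.mk (galoisRep ℓ n K L) ∘ₗ incl ℓ n K L

/-- The map `tr : k_n(L)_Σ → k_n(K)`. -/
def transferCoinv : GaloisCoinvariants ℓ n K L →ₗ[ℤ] MilnorKMod ℓ K n :=
  Representation.Coinvariants.lift (galoisRep ℓ n K L) (transfer ℓ n K L)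
    (transfer_galois ℓ n K L)

/-- `L` is obtained from `K` by adjoining an `ℓ`-th root of `a`. If `L/K` is cyclic of degree
`ℓ` and `K` contains the `ℓ`-th roots of unity, then the class `u = {a} ∈ k_1(K) = Kˣ/Kˣ^ℓ` is
the one which Kummer theory associates with `L/K`; it is unique up to the choice of a generator
of `Gal(L/K)` and of a primitive `ℓ`-th root of unity, that is, up to a factor in `(ℤ/ℓ)ˣ`. -/
def IsKummerGenerator (a : Kˣ) : Prop :=
  ∃ α : L, α ^ ℓ = algebraMap K L (a : K) ∧ IntermediateField.adjoin K {α} = ⊤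

/-- The sequence `k_n(K) → k_n(L)_Σ → k_n(K) → k_{n+1}(K)` with the maps `i`, `tr` and
multiplication by `u` is exact (for each choice of the class `u` of the extension). -/
structure FourTermExact : Prop where
  exact_coinvariants : Function.Exact (inclCoinv ℓ n K L) (transferCoinv ℓ n K L)
  exact_base : ∀ a : Kˣ, IsKummerGenerator ℓ K L a →
    Function.Exact (transferCoinv ℓ n K L) (unitMul ℓ n a)

end Extension

end MilnorKMod

end

/-! ### Steinberg maps and the Milnor ring modulo `ℓ` as a cyclic module -/

noncomputable section

namespace MilnorKMod

/-! Every finite extension of `F` has degree a power of `ℓ`, and inside a Galois extension it is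
reached from `F` by steps of degree `ℓ`. So it suffices to treat `L/K` of degree `ℓ` with
`k_{n+1}(K) = 0` (`IsSpecialField.subsingleton_of_finrank_eq`).

Exactness at `k_n(K)` makes `tr` surjective. On coinvariants `i ∘ tr` is multiplication by `ℓ`,
hence zero, so `i = 0`, and exactness at `k_n(L)_Σ` makes `tr : k_n(L)_Σ → k_n(K)` bijective
(`transferCoinv_bijective`). Now let `{c, v} ↦ [{c} · y]` with `tr y = {v}` define a map `k_{n+1}(K)
→ k_{n+1}(L)_Σ`. The crux is the Steinberg relation `a + c = 1`, with `a` the first entry of `v`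
(`mk_unitMul_eq_zero_of_steinberg`). One writes `c` as the norm of `1 - α` with `α ^ ℓ = a`: either
`α` lies in `L`, or one passes to `K(α)` and `L(α)` and uses exactness for `L(α)/K(α)`; if `a` is
already an `ℓ`-th power in `K`, then `{v} = 0`. As `k_{n+1}(K) = 0`, all classes `[{c} · y]` vanish.
Symbols with at most one entry outside `K` generate `k_{n+1}(L)`, and `n ≥ 1` leaves a constant
entry, so `k_{n+1}(L)_Σ = 0`. A group of order `ℓ` acting on an `ℓ`-torsion group without
coinvariants acts on the zero group, so `k_{n+1}(L) = 0`.

As `transfer` is chosen among the maps satisfying `IsTransfer` and is `0` if there are none,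
existence must be proved; this is the longest part (`exists_isTransfer`). Let `π` be the minimal
polynomial of a generator `α` of degree `ℓ`. All polynomials of degree below `ℓ` split, so `{f₁(α),
…, fₘ(α)}` can be sent to `{f₁, …, fₘ, π}` in the Milnor ring of the rational function field, modulo
symbols of functions with rational divisors. The transfer is the signed sum of the residues of this
symbol at the rational points of the projective line; by reciprocity it stands, up to sign, for the
contribution of the point `π`. -/

instance instAddCommGroup (ℓ : ℕ) (F : Type u) [Field F] (n : ℕ) :
    AddCommGroup (MilnorKMod ℓ F n) := inferInstance

/-- A map from the units of a field to a ring which turns products into sums and satisfies the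
Steinberg relation. -/
structure SteinbergMap (F : Type*) [Field F] (R : Type*) [Ring R] where
  toFun : Fˣ → R
  map_mul : ∀ a b, toFun (a * b) = toFun a + toFun b
  steinberg : ∀ a b : Fˣ, (a : F) + b = 1 → toFun a * toFun b = 0

namespace SteinbergMap

variable {F R : Type*} [Field F] [Ring R] (θ : SteinbergMap F R)

lemma map_one : θ.toFun 1 = 0 := by
  simpa using θ.map_mul 1 1

lemma map_inv (a : Fˣ) : θ.toFun a⁻¹ = -θ.toFun a := by
  have := θ.map_mul a a⁻¹
  rw [mul_inv_cancel, θ.map_one] at this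
  exact (neg_eq_of_add_eq_zero_right this.symm).symm

lemma map_div (a b : Fˣ) : θ.toFun (a / b) = θ.toFun a - θ.toFun b := by
  rw [div_eq_mul_inv, θ.map_mul, θ.map_inv, sub_eq_add_neg]

lemma map_pow (a : Fˣ) (k : ℕ) : θ.toFun (a ^ k) = k • θ.toFun a := by
  induction k with
  | zero => simp [θ.map_one]
  | succ k ih => rw [pow_succ, θ.map_mul, ih, succ_nsmul]

/-- For `a ≠ 1` write `-a = (1 - a) / (1 - a⁻¹)` and use the Steinberg relation for `a` and for
`a⁻¹`. -/
lemma mul_neg_self (a : Fˣ) : θ.toFun a * θ.toFun (-a) = 0 := by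
  by_cases h1 : a = 1
  · rw [h1, θ.map_one, zero_mul]
  have ha : (a : F) ≠ 0 := a.ne_zero
  have h1' : (a : F) ≠ 1 := fun h => h1 (Units.ext h)
  let b : Fˣ := Units.mk0 (1 - a : F) (sub_ne_zero.2 h1'.symm)
  let c : Fˣ := Units.mk0 (1 - (a : F)⁻¹) (sub_ne_zero.2 fun h => h1' (inv_eq_one.1 h.symm))
  have hbc : -a = b / c := by
    have hd : (1 : F) - (a : F)⁻¹ ≠ 0 := sub_ne_zero.2 fun h => h1' (inv_eq_one.1 h.symm)
    ext
    simp only [b, c, Units.val_neg, Units.val_div_eq_div_val, Units.val_mk0]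
    rw [eq_div_iff hd, mul_sub, neg_mul, neg_mul, mul_inv_cancel₀ ha]
    ring
  have hb := θ.steinberg a b (by simp [b])
  have hc := θ.steinberg a⁻¹ c (by simp [c])
  rw [θ.map_inv, neg_mul, neg_eq_zero] at hc
  rw [hbc, θ.map_div, mul_sub, hb, hc, sub_zero]

lemma anticomm (a b : Fˣ) : θ.toFun a * θ.toFun b = -(θ.toFun b * θ.toFun a) := by
  have h := θ.mul_neg_self (a * b)
  have ha : θ.toFun (-(a * b)) = θ.toFun (-a) + θ.toFun b := by rw [← θ.map_mul, neg_mul]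
  have hb : θ.toFun (-(a * b)) = θ.toFun a + θ.toFun (-b) := by rw [← θ.map_mul, mul_neg]
  rw [θ.map_mul a b, add_mul] at h
  nth_rw 1 [ha] at h
  rw [hb, mul_add, mul_add, θ.mul_neg_self, θ.mul_neg_self, zero_add, add_zero] at h
  exact eq_neg_of_add_eq_zero_left h

lemma mul_self (a : Fˣ) : θ.toFun a * θ.toFun a = θ.toFun a * θ.toFun (-1) := by
  have h := θ.mul_neg_self a
  have : θ.toFun (-a) = θ.toFun a + θ.toFun (-1) := by rw [← θ.map_mul]; simp
  rw [this, mul_add] at h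
  have h2 : θ.toFun (-1) + θ.toFun (-1) = 0 := by rw [← θ.map_mul]; simp [θ.map_one]
  rw [eq_neg_of_add_eq_zero_left h, ← mul_neg, neg_eq_of_add_eq_zero_left h2]

/-- A Steinberg map as an additive homomorphism. -/
def toLinear : Additive Fˣ →ₗ[ℤ] R :=
  AddMonoidHom.toIntLinearMap
    { toFun := fun a => θ.toFun a.toMul
      map_zero' := θ.map_one
      map_add' := fun _ _ => θ.map_mul _ _ }

end SteinbergMap

lemma prod_ofFn_eq_zero {R : Type*} [Ring R] {m : ℕ} (g : Fin m → R) (i j : Fin m)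
    (hij : j.val = i.val + 1) (h : g i * g j = 0) : (List.ofFn g).prod = 0 := by
  induction m with
  | zero => exact i.elim0
  | succ m ih =>
    rw [List.ofFn_succ, List.prod_cons]
    induction j using Fin.cases with
    | zero => simp at hij
    | succ j =>
      induction i using Fin.cases with
      | zero =>
        obtain _ | m := m
        · exact j.elim0
        have hj : j = 0 := Fin.ext (by simpa using hij)
        subst hj
        rw [List.ofFn_succ, List.prod_cons, ← mul_assoc, h, zero_mul]
      | succ i =>
        rw [ih (fun k => g k.succ) i j (by simpa using hij) h, mul_zero]

section Symbol

variable (ℓ : ℕ) {F : Type u} [Field F] {n : ℕ}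

/-- The symbol as a multilinear map. -/
def symbolMultilinear (n : ℕ) :
    MultilinearMap ℤ (fun _ : Fin n => Additive Fˣ) (MilnorKMod ℓ F n) :=
  (Submodule.mkQ _ ∘ₗ Submodule.mkQ (steinbergRelations F n)).compMultilinearMap
    (PiTensorProduct.tprod ℤ)

lemma symbol_eq (a : Fin n → Fˣ) :
    symbol ℓ a = symbolMultilinear ℓ n fun i => Additive.ofMul (a i) := rfl

lemma symbol_eq_zero (a : Fin n → Fˣ) (i j : Fin n) (hij : j.val = i.val + 1)
    (h : (a i : F) + a j = 1) : symbol ℓ a = 0 := by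
  have : (Submodule.Quotient.mk (unitTensor a) : MilnorK F n) = 0 :=
    (Submodule.Quotient.mk_eq_zero _).2 (Submodule.subset_span ⟨a, ⟨i, j, hij, h⟩, rfl⟩)
  rw [symbol, this, Submodule.Quotient.mk_zero]

lemma smul_eq_zero (x : MilnorKMod ℓ F n) : (ℓ : ℤ) • x = 0 := by
  induction x using Submodule.Quotient.induction_on with
  | _ x => exact (Submodule.Quotient.mk_eq_zero _).2 ⟨x, rfl⟩

/-- The universal property of `k_n(F)`. -/
def lift {A : Type*} [AddCommGroup A]
    (f : MultilinearMap ℤ (fun _ : Fin n => Additive Fˣ) A)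
    (hst : ∀ (a : Fin n → Fˣ) (i j : Fin n), j.val = i.val + 1 → (a i : F) + a j = 1 →
      f (fun k => Additive.ofMul (a k)) = 0)
    (hℓ : ∀ a, (ℓ : ℤ) • f a = 0) : MilnorKMod ℓ F n →ₗ[ℤ] A :=
  Submodule.liftQ _ (Submodule.liftQ _ (PiTensorProduct.lift f) (by
    refine Submodule.span_le.2 ?_
    rintro _ ⟨a, ⟨i, j, hij, h⟩, rfl⟩
    simpa [unitTensor] using hst a i j hij h)) (by
    rintro _ ⟨x, rfl⟩
    have : (ℓ : ℤ) • (Submodule.liftQ (steinbergRelations F n) (PiTensorProduct.lift f) (by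
        refine Submodule.span_le.2 ?_
        rintro _ ⟨a, ⟨i, j, hij, h⟩, rfl⟩
        simpa [unitTensor] using hst a i j hij h)) = 0 := by
      refine Submodule.linearMap_qext _ (PiTensorProduct.ext ?_)
      ext a
      exact (congrArg ((ℓ : ℤ) • ·) (PiTensorProduct.lift.tprod a)).trans (hℓ a)
    simpa using LinearMap.congr_fun this x)

lemma lift_symbol {A : Type*} [AddCommGroup A]
    (f : MultilinearMap ℤ (fun _ : Fin n => Additive Fˣ) A) (hst hℓ) (a : Fin n → Fˣ) :
    lift ℓ f hst hℓ (symbol ℓ a) = f fun i => Additive.ofMul (a i) := by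
  exact PiTensorProduct.lift.tprod (R := ℤ) (s := fun _ : Fin n => Additive Fˣ) (E := A)
    (φ := f) (fun i => Additive.ofMul (a i))

lemma unitMul_mul (a b : Fˣ) : unitMul ℓ n (a * b) = unitMul ℓ n a + unitMul ℓ n b := by
  refine hom_ext fun v => ?_
  have key (c : Fˣ) : symbol ℓ (Fin.cons c v : Fin (n + 1) → Fˣ) =
      symbolMultilinear ℓ (n + 1)
        (Fin.cons (Additive.ofMul c) fun i => Additive.ofMul (v i)) := by
    rw [symbol_eq]
    refine congrArg _ (funext fun i => ?_)
    refine Fin.cases ?_ (fun _ => ?_) i <;> rfl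
  rw [LinearMap.add_apply, unitMul_symbol, unitMul_symbol, unitMul_symbol, key, key, key, ofMul_mul,
    MultilinearMap.cons_add]

lemma unitMul_unitMul_eq_zero (a b : Fˣ) (h : (a : F) + b = 1) (x : MilnorKMod ℓ F n) :
    unitMul ℓ (n + 1) a (unitMul ℓ n b x) = 0 := by
  have : unitMul ℓ (n + 1) a ∘ₗ unitMul ℓ n b = 0 := by
    refine hom_ext fun v => ?_
    rw [LinearMap.comp_apply, unitMul_symbol, unitMul_symbol]
    exact symbol_eq_zero ℓ _ 0 1 rfl h
  exact LinearMap.congr_fun this x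

lemma map_unitMul {F' : Type u} [Field F'] (f : F →+* F') (a : Fˣ) (x : MilnorKMod ℓ F n) :
    map ℓ (n + 1) f (unitMul ℓ n a x) = unitMul ℓ n (Units.map (f : F →* F') a) (map ℓ n f x) := by
  have : map ℓ (n + 1) f ∘ₗ unitMul ℓ n a =
      unitMul ℓ n (Units.map (f : F →* F') a) ∘ₗ map ℓ n f := by
    refine hom_ext fun v => ?_
    rw [LinearMap.comp_apply, LinearMap.comp_apply, unitMul_symbol, map_symbol, map_symbol,
      unitMul_symbol]
    refine congrArg _ (funext fun i => ?_)
    refine Fin.cases ?_ (fun _ => ?_) i <;> rfl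
  exact LinearMap.congr_fun this x

variable (F) in
/-- The Milnor ring modulo `ℓ`, as a graded group. -/
abbrev Total : Type u := DirectSum ℕ fun n => MilnorKMod ℓ F n

namespace Total

/-- The unit of the Milnor ring. -/
def one : Total ℓ F := DirectSum.lof ℤ ℕ (fun n => MilnorKMod ℓ F n) 0 (symbol ℓ Fin.elim0)

/-- Left multiplication by units on the Milnor ring. -/
def mulLeft : SteinbergMap F (Module.End ℤ (Total ℓ F)) where
  toFun a := DirectSum.toModule ℤ ℕ _ fun n =>
    DirectSum.lof ℤ ℕ (fun n => MilnorKMod ℓ F n) (n + 1) ∘ₗ unitMul ℓ n a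
  map_mul a b := by
    ext n : 1
    refine LinearMap.ext fun x => ?_
    simp only [LinearMap.comp_apply, LinearMap.add_apply, DirectSum.toModule_lof, unitMul_mul,
      map_add]
  steinberg a b h := by
    ext n : 1
    refine LinearMap.ext fun x => ?_
    simp only [LinearMap.comp_apply, Module.End.mul_apply, DirectSum.toModule_lof,
      unitMul_unitMul_eq_zero ℓ a b h, map_zero, LinearMap.zero_apply]

lemma mulLeft_lof (a : Fˣ) (x : MilnorKMod ℓ F n) :
    (mulLeft ℓ).toFun a (DirectSum.lof ℤ ℕ (fun n => MilnorKMod ℓ F n) n x) =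
      DirectSum.lof ℤ ℕ (fun n => MilnorKMod ℓ F n) (n + 1) (unitMul ℓ n a x) := by
  simp only [mulLeft, DirectSum.toModule_lof, LinearMap.comp_apply]

lemma smul_eq_zero (x : Total ℓ F) : (ℓ : ℤ) • x = 0 := by
  refine DFinsupp.ext fun n => ?_
  rw [DirectSum.smul_apply]
  exact MilnorKMod.smul_eq_zero ℓ (x n)

-- The Milnor ring is generated by `one` under left multiplication by units; this replaces an
-- induction on degree and entries.
variable {ℓ} in
lemma hom_ext {A : Type*} [AddCommGroup A] {f g : Total ℓ F →ₗ[ℤ] A}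
    (h1 : f (one ℓ) = g (one ℓ))
    (h : ∀ a x, f x = g x → f ((mulLeft ℓ).toFun a x) = g ((mulLeft ℓ).toFun a x)) : f = g := by
  ext n : 1
  refine MilnorKMod.hom_ext fun a => ?_
  simp only [LinearMap.comp_apply]
  induction n with
  | zero => rwa [Subsingleton.elim a Fin.elim0]
  | succ n ih =>
    have := h (a 0) _ (ih (fun i => a i.succ))
    rw [mulLeft_lof, unitMul_symbol] at this
    rwa [← Fin.cons_self_tail a]

lemma span_induction (N : Submodule ℤ (Total ℓ F)) (h1 : one ℓ ∈ N)
    (h : ∀ a, ∀ x ∈ N, (mulLeft ℓ).toFun a x ∈ N) (x : Total ℓ F) : x ∈ N := by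
  have : N.mkQ = 0 := by
    refine hom_ext ?_ fun a x hx => ?_
    · simpa using h1
    · rw [LinearMap.zero_apply, Submodule.mkQ_apply, Submodule.Quotient.mk_eq_zero] at hx ⊢
      exact h a x hx
  simpa using LinearMap.congr_fun this x

section Lift

variable {M : Type*} [AddCommGroup M] (θ : SteinbergMap F (Module.End ℤ M)) (m₀ : M)
  (hm : (ℓ : ℤ) • m₀ = 0)

/-- The universal property of the Milnor ring as a cyclic module. -/
def lift : Total ℓ F →ₗ[ℤ] M :=
  DirectSum.toModule ℤ ℕ M fun n => MilnorKMod.lift ℓ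
    (((LinearMap.applyₗ m₀).compMultilinearMap
      (MultilinearMap.mkPiAlgebraFin ℤ n (Module.End ℤ M))).compLinearMap fun _ => θ.toLinear)
    (fun a i j hij h => by
      have := prod_ofFn_eq_zero (fun k => θ.toFun (a k)) i j hij (θ.steinberg _ _ h)
      simpa [SteinbergMap.toLinear] using LinearMap.congr_fun this m₀)
    (fun a => by
      rw [MultilinearMap.compLinearMap_apply, LinearMap.compMultilinearMap_apply,
        LinearMap.applyₗ_apply_apply, ← LinearMap.map_smul, hm, LinearMap.map_zero])

lemma lift_lof_symbol (a : Fin n → Fˣ) :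
    lift ℓ θ m₀ hm (DirectSum.lof ℤ ℕ (fun n => MilnorKMod ℓ F n) n (symbol ℓ a)) =
      (List.ofFn fun i => θ.toFun (a i)).prod m₀ := by
  rw [lift, DirectSum.toModule_lof, lift_symbol]
  simp [SteinbergMap.toLinear]

lemma lift_one : lift ℓ θ m₀ hm (one ℓ) = m₀ := by
  simp [one, lift_lof_symbol]

lemma lift_mulLeft (a : Fˣ) (x : Total ℓ F) :
    lift ℓ θ m₀ hm ((mulLeft ℓ).toFun a x) = θ.toFun a (lift ℓ θ m₀ hm x) := by
  have : lift ℓ θ m₀ hm ∘ₗ (mulLeft ℓ).toFun a = θ.toFun a ∘ₗ lift ℓ θ m₀ hm := by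
    ext n : 1
    refine MilnorKMod.hom_ext fun v => ?_
    simp only [LinearMap.comp_apply]
    rw [mulLeft_lof, unitMul_symbol, lift_lof_symbol, lift_lof_symbol]
    simp [List.ofFn_succ]
  exact LinearMap.congr_fun this x

end Lift

variable (F) in
/-- The sign automorphism, `(-1)^n` in degree `n`. -/
def sign : Total ℓ F →ₗ[ℤ] Total ℓ F :=
  DirectSum.toModule ℤ ℕ _ fun n => ((-1) ^ n : ℤ) • DirectSum.lof ℤ ℕ (fun n => MilnorKMod ℓ F n) n

lemma sign_one : sign ℓ F (one ℓ) = one ℓ := by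
  simp [one, sign, DirectSum.toModule_lof]

lemma sign_mulLeft (a : Fˣ) (x : Total ℓ F) :
    sign ℓ F ((mulLeft ℓ).toFun a x) = -(mulLeft ℓ).toFun a (sign ℓ F x) := by
  have : sign ℓ F ∘ₗ (mulLeft ℓ).toFun a = -((mulLeft ℓ).toFun a ∘ₗ sign ℓ F) := by
    ext n : 1
    refine LinearMap.ext fun x => ?_
    simp only [LinearMap.comp_apply, LinearMap.neg_apply, mulLeft_lof, sign, DirectSum.toModule_lof,
      LinearMap.smul_apply, LinearMap.map_smul, pow_succ, mul_neg_one, neg_smul]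
  exact LinearMap.congr_fun this x

end Total

end Symbol

end MilnorKMod

end

/-! ### Residue and specialization for a discrete valuation -/

noncomputable section

namespace MilnorKMod

/-- A discrete valuation on `E` together with an angular component with values in the residue
field `κ`, that is, the leading coefficient for some choice of a uniformizer. -/
structure TameDatum (E κ : Type*) [Field E] [Field κ] where
  val : Eˣ → ℤ
  ac : Eˣ → κˣ
  val_mul : ∀ a b, val (a * b) = val a + val b
  ac_mul : ∀ a b, ac (a * b) = ac a * ac b
  add_eq_one : ∀ a b : Eˣ, (a : E) + b = 1 →
    (val a = 0 ∧ ac a = 1) ∨ (val b = 0 ∧ ac b = 1) ∨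
    (val a = 0 ∧ val b = 0 ∧ (ac a : κ) + ac b = 1) ∨ (val b = val a ∧ ac b = -ac a)

namespace TameDatum

variable (ℓ : ℕ) {E κ : Type u} [Field E] [Field κ] (P : TameDatum E κ)

/-- The action of `a = u ϖ^i` by left multiplication with `{u} + i ξ` on the Milnor ring of the
residue field extended by a variable `ξ` of degree `1` with `ξ² = {-1} ξ`. -/
def action : SteinbergMap E (Module.End ℤ (Total ℓ κ × Total ℓ κ)) where
  toFun a := LinearMap.prod
    ((Total.mulLeft ℓ).toFun (P.ac a) ∘ₗ LinearMap.fst ℤ _ _)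
    (P.val a • LinearMap.fst ℤ _ _ - (Total.mulLeft ℓ).toFun (P.ac a) ∘ₗ LinearMap.snd ℤ _ _ +
      P.val a • (Total.mulLeft ℓ).toFun (-1) ∘ₗ LinearMap.snd ℤ _ _)
  map_mul a b := by
    refine LinearMap.ext fun x => ?_
    simp only [P.val_mul, P.ac_mul, (Total.mulLeft ℓ).map_mul]
    refine Prod.ext ?_ ?_
    · simp
    · simp [add_smul]
      abel
  steinberg a b h := by
    -- The pair `(s, d)` stands for `s + ξ d`. In the first two cases of `add_eq_one` one factor
    -- acts as zero, in the third the relation is that of `κ`, and in the last the poles cancel.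
    refine LinearMap.ext fun x => ?_
    obtain ⟨s, d⟩ := x
    rcases P.add_eq_one a b h with ⟨h1, h2⟩ | ⟨h1, h2⟩ | ⟨h1, h2, h3⟩ | ⟨h1, h2⟩
    · simp [h1, h2, (Total.mulLeft ℓ).map_one]
    · simp [h1, h2, (Total.mulLeft ℓ).map_one]
    · have h4 (x) := LinearMap.congr_fun ((Total.mulLeft ℓ).steinberg _ _ h3) x
      simp only [Module.End.mul_apply, LinearMap.zero_apply] at h4
      simp [h1, h2, h4]
    · have h3 : (Total.mulLeft ℓ).toFun (-P.ac a) =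
          (Total.mulLeft ℓ).toFun (P.ac a) + (Total.mulLeft ℓ).toFun (-1) := by
        rw [← (Total.mulLeft ℓ).map_mul]; simp
      have h4 (x) := LinearMap.congr_fun ((Total.mulLeft ℓ).mul_neg_self (P.ac a)) x
      have h5 (x) := LinearMap.congr_fun ((Total.mulLeft ℓ).anticomm (-1) (P.ac a)) x
      have h6 : (Total.mulLeft ℓ).toFun (-1 : κˣ) + (Total.mulLeft ℓ).toFun (-1) = 0 := by
        rw [← (Total.mulLeft ℓ).map_mul]; simp [(Total.mulLeft ℓ).map_one]
      -- The coefficient `i (i + 1)` is even and `2 {-1} = 0`.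
      have h7 (x) : (P.val a * (P.val a + 1)) • (Total.mulLeft ℓ).toFun (-1 : κˣ) x = 0 := by
        obtain ⟨k, hk⟩ := Int.even_mul_succ_self (P.val a)
        rw [hk, add_smul, ← smul_add, ← LinearMap.add_apply, h6, LinearMap.zero_apply, smul_zero]
      have h8 (x) := LinearMap.congr_fun h6 x
      simp only [h3, Module.End.mul_apply, LinearMap.zero_apply, LinearMap.add_apply,
        LinearMap.neg_apply] at h4 h5 h8
      refine Prod.ext ?_ ?_
      · simp [h1, h2, h3, h4]
      · have h9 := h7 s
        have h10 := h7 ((Total.mulLeft ℓ).toFun (-1 : κˣ) d)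
        have h11 := h4 d
        have h12 := h8 ((Total.mulLeft ℓ).toFun (-1 : κˣ) d)
        simp only [LinearMap.map_add] at h11
        simp only [mul_add, mul_one, add_smul, mul_smul] at h9 h10
        simp only [Module.End.mul_apply, LinearMap.prod_apply, Function.prod, LinearMap.comp_apply,
          LinearMap.fst_apply, LinearMap.snd_apply, LinearMap.add_apply, LinearMap.sub_apply,
          LinearMap.smul_apply, LinearMap.map_add, LinearMap.map_sub, LinearMap.map_smul,
          h1, h2, h3, LinearMap.zero_apply, Prod.snd_zero, h5]
        linear_combination (norm := module) h9 + h11 + h10 - P.val a • h12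

/-- The residue homomorphism, together with the specialization homomorphism. -/
def residue : Total ℓ E →ₗ[ℤ] Total ℓ κ × Total ℓ κ :=
  Total.lift ℓ (P.action ℓ) (Total.one ℓ, 0) (by
    rw [Prod.smul_mk, Total.smul_eq_zero, smul_zero]; rfl)

lemma residue_one : P.residue ℓ (Total.one ℓ) = (Total.one ℓ, 0) := Total.lift_one ..

lemma residue_mulLeft (a : Eˣ) (x : Total ℓ E) :
    P.residue ℓ ((Total.mulLeft ℓ).toFun a x) =
      ((Total.mulLeft ℓ).toFun (P.ac a) (P.residue ℓ x).1,
        P.val a • (P.residue ℓ x).1 - (Total.mulLeft ℓ).toFun (P.ac a) (P.residue ℓ x).2 +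
          P.val a • (Total.mulLeft ℓ).toFun (-1) (P.residue ℓ x).2) :=
  Total.lift_mulLeft ..

end TameDatum

end MilnorKMod

end

/-! ### Valuations of the rational function field at rational points and at infinity -/

noncomputable section

namespace MilnorKMod

namespace TameDatum

section Laurent

variable {κ : Type*} [Field κ]

lemma order_eq_of_coeff {x : LaurentSeries κ} {i : ℤ} (hi : x.coeff i ≠ 0)
    (h : ∀ j < i, x.coeff j = 0) : x.order = i := by
  refine le_antisymm (HahnSeries.order_le_of_coeff_ne_zero hi) ?_
  by_contra! hlt
  have hx : x ≠ 0 := by rintro rfl; simp at hi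
  exact hx ((HahnSeries.coeff_order_eq_zero).1 (h _ hlt))

/-- The sign of the order decides: a summand of positive order leaves the other equal to `1` to
leading order, a summand of negative order must have its leading term cancelled, and two summands of
order `0` have leading coefficients adding to `1`. -/
lemma laurent_add_eq_one {x y : LaurentSeries κ} (hx : x ≠ 0) (hy : y ≠ 0) (h : x + y = 1) :
    (x.order = 0 ∧ x.leadingCoeff = 1) ∨ (y.order = 0 ∧ y.leadingCoeff = 1) ∨
    (x.order = 0 ∧ y.order = 0 ∧ x.leadingCoeff + y.leadingCoeff = 1) ∨
    (y.order = x.order ∧ y.leadingCoeff = -x.leadingCoeff) := by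
  have hc (n : ℤ) (hn : n ≠ 0) : x.coeff n + y.coeff n = 0 := by
    rw [← HahnSeries.coeff_add, h, HahnSeries.coeff_one, if_neg hn]
  have h0 : x.coeff 0 + y.coeff 0 = 1 := by
    rw [← HahnSeries.coeff_add, h, HahnSeries.coeff_one, if_pos rfl]
  have pos {x y : LaurentSeries κ} (hc : ∀ n : ℤ, n ≠ 0 → x.coeff n + y.coeff n = 0)
      (h0 : x.coeff 0 + y.coeff 0 = 1) (hx : 0 < x.order) :
      y.order = 0 ∧ y.leadingCoeff = 1 := by
    rw [HahnSeries.coeff_eq_zero_of_lt_order hx, zero_add] at h0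
    have : y.order = 0 := by
      refine order_eq_of_coeff (by rw [h0]; exact one_ne_zero) fun j hj => ?_
      have := hc j hj.ne
      rwa [HahnSeries.coeff_eq_zero_of_lt_order (hj.trans hx), zero_add] at this
    refine ⟨this, ?_⟩
    rw [HahnSeries.leadingCoeff_eq, this, h0]
  have neg {x y : LaurentSeries κ} (hx : x ≠ 0)
      (hc : ∀ n : ℤ, n ≠ 0 → x.coeff n + y.coeff n = 0) (hneg : x.order < 0) :
      y.order = x.order ∧ y.leadingCoeff = -x.leadingCoeff := by
    have h1 := hc _ hneg.ne
    have : y.order = x.order := by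
      refine order_eq_of_coeff ?_ fun j hj => ?_
      · rw [eq_neg_of_add_eq_zero_right h1, neg_ne_zero]
        exact fun h => hx (HahnSeries.coeff_order_eq_zero.1 h)
      · have := hc j (hj.trans hneg).ne
        rwa [HahnSeries.coeff_eq_zero_of_lt_order hj, zero_add] at this
    refine ⟨this, ?_⟩
    rw [HahnSeries.leadingCoeff_eq, HahnSeries.leadingCoeff_eq, this]
    exact eq_neg_of_add_eq_zero_right h1
  have hc' (n : ℤ) (hn : n ≠ 0) : y.coeff n + x.coeff n = 0 := by rw [add_comm, hc n hn]
  rcases lt_trichotomy x.order 0 with hxo | hxo | hxo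
  · exact .inr (.inr (.inr (neg hx hc hxo)))
  · rcases lt_trichotomy y.order 0 with hyo | hyo | hyo
    · have := neg hy hc' hyo
      exact .inr (.inr (.inr ⟨this.1.symm, by rw [this.2, neg_neg]⟩))
    · refine .inr (.inr (.inl ⟨hxo, hyo, ?_⟩))
      rw [HahnSeries.leadingCoeff_eq, HahnSeries.leadingCoeff_eq, hxo, hyo, h0]
    · exact .inl (pos hc' (by rw [add_comm, h0]) hyo)
  · exact .inr (.inl (pos hc h0 hxo))

variable {E : Type*} [Field E]

/-- The tame datum of an embedding into a field of Laurent series. -/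
def ofLaurent (φ : E →+* LaurentSeries κ) : TameDatum E κ where
  val a := (φ a).order
  ac a := Units.mk0 (φ a).leadingCoeff (by simp)
  val_mul a b := by
    rw [Units.val_mul, map_mul, HahnSeries.order_mul (by simp) (by simp)]
  ac_mul a b := Units.ext (by simp [HahnSeries.leadingCoeff_mul])
  add_eq_one a b h := by
    have := laurent_add_eq_one (x := φ a) (y := φ b) (by simp) (by simp)
      (by rw [← map_add, h, map_one])
    simpa [Units.ext_iff] using this

end Laurent

section RatFunc

open Polynomial

variable {L : Type*} [Field L]

/-- A nonzero polynomial as a unit of the field of rational functions. -/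
def polyUnit (p : L[X]) (hp : p ≠ 0) : (RatFunc L)ˣ :=
  Units.mk0 (algebraMap L[X] (RatFunc L) p) (by simpa using hp)

lemma polyUnit_mul (p q : L[X]) (hp : p ≠ 0) (hq : q ≠ 0) :
    polyUnit (p * q) (mul_ne_zero hp hq) = polyUnit p hp * polyUnit q hq :=
  Units.ext (by simp [polyUnit])

lemma exists_eq_polyUnit_div (x : (RatFunc L)ˣ) :
    ∃ (p q : L[X]) (hp : p ≠ 0) (hq : q ≠ 0), x = polyUnit p hp / polyUnit q hq := by
  refine ⟨(x : RatFunc L).num, (x : RatFunc L).denom, ?_, RatFunc.denom_ne_zero _, ?_⟩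
  · simp
  · ext
    simp [polyUnit, RatFunc.num_div_denom]

/-- The expansion of rational functions at the point `c`. -/
def expansionAt (c : L) : RatFunc L →+* LaurentSeries L :=
  IsFractionRing.lift (A := L[X]) (g := (HahnSeries.ofPowerSeries ℤ L).comp
    (Polynomial.coeToPowerSeries.ringHom.comp (taylorEquiv c).toRingHom)) (by
      refine HahnSeries.ofPowerSeries_injective.comp ?_
      exact (Polynomial.coe_injective L).comp (taylorEquiv c).injective)

lemma expansionAt_algebraMap (c : L) (p : L[X]) :
    expansionAt c (algebraMap _ _ p) = HahnSeries.ofPowerSeries ℤ L (taylor c p : L[X]) := by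
  rw [expansionAt, IsFractionRing.lift_algebraMap]
  rfl

/-- The tame datum of the point `c` of the affine line. -/
def atPoint (c : L) : TameDatum (RatFunc L) L := ofLaurent (expansionAt c)

lemma atPoint_polyUnit (c : L) (p : L[X]) (hp : p ≠ 0) (h : p.eval c ≠ 0) :
    (atPoint c).val (polyUnit p hp) = 0 ∧ ((atPoint c).ac (polyUnit p hp) : L) = p.eval c := by
  have h0 : (HahnSeries.ofPowerSeries ℤ L (taylor c p : L[X])).coeff 0 = p.eval c := by
    have := HahnSeries.ofPowerSeries_apply_coeff (Γ := ℤ) ((taylor c p : L[X]) : PowerSeries L) 0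
    simpa [taylor_coeff_zero] using this
  have ho : (HahnSeries.ofPowerSeries ℤ L (taylor c p : L[X])).order = 0 := by
    refine order_eq_of_coeff (by rwa [h0]) fun j hj => ?_
    rw [HahnSeries.ofPowerSeries_apply]
    refine HahnSeries.embDomain_of_notMem_range ?_
    rintro ⟨k, hk⟩
    simp at hk
    lia
  constructor
  · simp only [atPoint, ofLaurent, polyUnit, Units.val_mk0, expansionAt_algebraMap, ho]
  · simp only [atPoint, ofLaurent, polyUnit, Units.val_mk0, expansionAt_algebraMap,
      HahnSeries.leadingCoeff_eq, ho, h0]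

lemma atPoint_X_sub_C_self (c : L) :
    (atPoint c).val (polyUnit (X - C c) (X_sub_C_ne_zero c)) = 1 ∧
      (atPoint c).ac (polyUnit (X - C c) (X_sub_C_ne_zero c)) = 1 := by
  have : expansionAt c (algebraMap _ _ (X - C c)) = HahnSeries.single 1 1 := by
    rw [expansionAt_algebraMap]
    simp
  constructor
  · simp [atPoint, ofLaurent, polyUnit, - map_sub, this]
  · ext
    simp [atPoint, ofLaurent, polyUnit, - map_sub, this]

/-- The expansion of polynomials at infinity. -/
def polyExpansionAtInfty : L[X] →+* LaurentSeries L :=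
  eval₂RingHom HahnSeries.C (HahnSeries.single (-1 : ℤ) 1)

lemma coeff_polyExpansionAtInfty (p : L[X]) (k : ℕ) :
    (polyExpansionAtInfty p).coeff (-k : ℤ) = p.coeff k := by
  induction p using Polynomial.induction_on' with
  | add p q hp hq => simp [hp, hq]
  | monomial i a =>
    simp [polyExpansionAtInfty, eval₂_monomial, HahnSeries.single_pow, HahnSeries.C_apply,
      HahnSeries.coeff_single, coeff_monomial, eq_comm]

/-- The expansion of rational functions at infinity. -/
def expansionAtInfty : RatFunc L →+* LaurentSeries L :=
  IsFractionRing.lift (A := L[X]) (g := polyExpansionAtInfty) (by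
    rw [injective_iff_map_eq_zero]
    intro p hp
    ext k
    rw [← coeff_polyExpansionAtInfty, hp]
    simp)

/-- The tame datum of the point at infinity. -/
def atInfty : TameDatum (RatFunc L) L := ofLaurent expansionAtInfty

/-- The uniformizer is `X⁻¹`, so the leading term of the expansion is the leading term of the
polynomial. -/
lemma atInfty_polyUnit (p : L[X]) (hp : p ≠ 0) :
    atInfty.val (polyUnit p hp) = -p.natDegree ∧
      (atInfty.ac (polyUnit p hp) : L) = p.leadingCoeff := by
  have ho : (polyExpansionAtInfty p).order = -(p.natDegree : ℤ) := by
    refine order_eq_of_coeff ?_ fun j hj => ?_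
    · rw [coeff_polyExpansionAtInfty]
      exact leadingCoeff_ne_zero.2 hp
    · obtain ⟨k, hk⟩ := Int.eq_ofNat_of_zero_le (a := -j) (by lia)
      rw [show j = -(k : ℤ) by lia, coeff_polyExpansionAtInfty]
      exact coeff_eq_zero_of_natDegree_lt (by lia)
  constructor
  · simp [atInfty, ofLaurent, polyUnit, expansionAtInfty, ho]
  · simp only [atInfty, ofLaurent, polyUnit, expansionAtInfty, Units.val_mk0,
      IsFractionRing.lift_algebraMap, HahnSeries.leadingCoeff_eq, ho, coeff_polyExpansionAtInfty]
    rfl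

/-- Zeros and poles are among the roots of numerator and denominator. This finiteness makes the sum
of residues additive. -/
lemma finite_val_atPoint_ne_zero (x : (RatFunc L)ˣ) :
    {c : L | (atPoint c).val x ≠ 0}.Finite := by
  obtain ⟨p, q, hp, hq, rfl⟩ := exists_eq_polyUnit_div x
  refine ((p.rootSet_finite L).union (q.rootSet_finite L)).subset fun c hc => ?_
  by_contra h
  simp only [Set.mem_union, mem_rootSet, hp, hq, not_or, coe_aeval_eq_eval, ne_eq,
    not_false_eq_true, true_and] at h
  refine hc ?_
  have h1 := (atPoint_polyUnit c p hp h.1).1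
  have h2 := (atPoint_polyUnit c q hq h.2).1
  have h3 := (atPoint c).val_mul (polyUnit p hp / polyUnit q hq) (polyUnit q hq)
  rwa [div_mul_cancel, h1, h2, add_zero, eq_comm] at h3

end RatFunc

end TameDatum

end MilnorKMod

end

/-! ### Generation by symbols with at most one nonconstant entry -/

noncomputable section

namespace MilnorKMod

section Generation

variable (ℓ : ℕ) {K E : Type u} [Field K] [Field E] (ι : K →+* E) (τ : E) (hτ : ∀ c, τ ≠ ι c)

/-- The element `τ - c` as a unit. -/
def linearUnit (c : K) : Eˣ := Units.mk0 (τ - ι c) (sub_ne_zero.2 (hτ c))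

/-- The group generated by the constants and the linear expressions `τ - c`. -/
def splitUnits : Subgroup Eˣ :=
  Subgroup.closure (Set.range (Units.map (ι : K →* E)) ∪ Set.range (linearUnit ι τ hτ))

/-- Symbols all of whose entries but possibly the last one are constants, the last one being
a constant or linear. -/
inductive IsLinearSymbol : Total ℓ E → Prop
  | one : IsLinearSymbol (Total.one ℓ)
  | linear (c : K) :
      IsLinearSymbol ((Total.mulLeft ℓ).toFun (linearUnit ι τ hτ c) (Total.one ℓ))
  | mul (a : Kˣ) (x : Total ℓ E) : IsLinearSymbol x →
      IsLinearSymbol ((Total.mulLeft ℓ).toFun (Units.map (ι : K →* E) a) x)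

/-- The group spanned by the symbols with at most one nonconstant entry. -/
def linearSpan : Submodule ℤ (Total ℓ E) := Submodule.span ℤ {x | IsLinearSymbol ℓ ι τ hτ x}

lemma one_mem_linearSpan : Total.one ℓ ∈ linearSpan ℓ ι τ hτ := Submodule.subset_span .one

lemma mulLeft_const_mem_linearSpan (a : Kˣ) {x : Total ℓ E} (hx : x ∈ linearSpan ℓ ι τ hτ) :
    (Total.mulLeft ℓ).toFun (Units.map (ι : K →* E) a) x ∈ linearSpan ℓ ι τ hτ := by
  have : (linearSpan ℓ ι τ hτ).map ((Total.mulLeft ℓ).toFun (Units.map (ι : K →* E) a)) ≤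
      linearSpan ℓ ι τ hτ :=
    (Submodule.map_span_le _ _ _).2 fun y hy => Submodule.subset_span (.mul a y hy)
  exact this ⟨x, hx, rfl⟩

/-- This is the Steinberg relation for `(τ - c)/(d - c) + (τ - d)/(c - d) = 1`, expanded; each term
on the right has at most one of the two linear factors. -/
lemma mulLeft_linear_linear (c d : K) (x : Total ℓ E) (hcd : c ≠ d) :
    (Total.mulLeft ℓ).toFun (linearUnit ι τ hτ c)
      ((Total.mulLeft ℓ).toFun (linearUnit ι τ hτ d) x) =
      (Total.mulLeft ℓ).toFun (linearUnit ι τ hτ c) ((Total.mulLeft ℓ).toFun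
        (Units.map (ι : K →* E) (Units.mk0 (c - d) (sub_ne_zero.2 hcd))) x) +
      (Total.mulLeft ℓ).toFun (Units.map (ι : K →* E) (Units.mk0 (d - c) (sub_ne_zero.2 hcd.symm)))
        ((Total.mulLeft ℓ).toFun (linearUnit ι τ hτ d) x) -
      (Total.mulLeft ℓ).toFun (Units.map (ι : K →* E) (Units.mk0 (d - c) (sub_ne_zero.2 hcd.symm)))
        ((Total.mulLeft ℓ).toFun
          (Units.map (ι : K →* E) (Units.mk0 (c - d) (sub_ne_zero.2 hcd))) x) := by
  have hcd' : ι c ≠ ι d := fun h => hcd (ι.injective h)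
  have h1 : ι c - ι d ≠ 0 := sub_ne_zero.2 hcd'
  have h2 : ι d - ι c ≠ 0 := sub_ne_zero.2 hcd'.symm
  have h := (Total.mulLeft (F := E) ℓ).steinberg
    (linearUnit ι τ hτ c / Units.map (ι : K →* E) (Units.mk0 (d - c) (sub_ne_zero.2 hcd.symm)))
    (linearUnit ι τ hτ d / Units.map (ι : K →* E) (Units.mk0 (c - d) (sub_ne_zero.2 hcd)))
    (by
      simp [linearUnit, Units.val_div_eq_div_val]
      rw [← neg_sub (ι c) (ι d), div_neg, ← neg_div, ← add_div, div_eq_one_iff_eq h1]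
      ring)
  have h := LinearMap.congr_fun h x
  rw [SteinbergMap.map_div, SteinbergMap.map_div] at h
  simp only [Module.End.mul_apply, LinearMap.sub_apply, LinearMap.map_sub,
    LinearMap.zero_apply] at h
  linear_combination (norm := module) h

/-- A constant in front is moved past by anticommutativity. Two linear entries are merged by
`mulLeft_linear_linear` if distinct and by `{x, x} = {x, -1}` if equal. -/
lemma mulLeft_linear_mem_linearSpan (c : K) {x : Total ℓ E} (hx : x ∈ linearSpan ℓ ι τ hτ) :
    (Total.mulLeft ℓ).toFun (linearUnit ι τ hτ c) x ∈ linearSpan ℓ ι τ hτ := by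
  have hanti (a : Kˣ) (y : Total ℓ E) (hy : (Total.mulLeft ℓ).toFun (linearUnit ι τ hτ c) y ∈
      linearSpan ℓ ι τ hτ) : (Total.mulLeft ℓ).toFun (linearUnit ι τ hτ c)
        ((Total.mulLeft ℓ).toFun (Units.map (ι : K →* E) a) y) ∈ linearSpan ℓ ι τ hτ := by
    rw [← Module.End.mul_apply, SteinbergMap.anticomm, LinearMap.neg_apply, Module.End.mul_apply]
    exact neg_mem (mulLeft_const_mem_linearSpan ℓ ι τ hτ a hy)
  have hlin (d : K) : (Total.mulLeft ℓ).toFun (linearUnit ι τ hτ d) (Total.one ℓ) ∈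
      linearSpan ℓ ι τ hτ := Submodule.subset_span (.linear d)
  have : (linearSpan ℓ ι τ hτ).map ((Total.mulLeft ℓ).toFun (linearUnit ι τ hτ c)) ≤
      linearSpan ℓ ι τ hτ := by
    refine (Submodule.map_span_le _ _ _).2 fun y hy => ?_
    induction hy with
    | one => exact hlin c
    | linear d =>
      by_cases hcd : c = d
      · subst hcd
        rw [← Module.End.mul_apply, SteinbergMap.mul_self, Module.End.mul_apply]
        have := hanti (-1) _ (hlin c)
        rwa [show Units.map (ι : K →* E) (-1) = -1 from Units.ext (by simp)] at this
      · rw [mulLeft_linear_linear ℓ ι τ hτ c d _ hcd]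
        exact sub_mem (add_mem (hanti _ _ (hlin c))
          (mulLeft_const_mem_linearSpan ℓ ι τ hτ _ (hlin d)))
          (mulLeft_const_mem_linearSpan ℓ ι τ hτ _
            (mulLeft_const_mem_linearSpan ℓ ι τ hτ _ (one_mem_linearSpan ℓ ι τ hτ)))
    | mul a x _ ih => exact hanti a x ih
  exact this ⟨x, hx, rfl⟩

lemma mulLeft_mem_linearSpan {g : Eˣ} (hg : g ∈ splitUnits ι τ hτ) {x : Total ℓ E}
    (hx : x ∈ linearSpan ℓ ι τ hτ) : (Total.mulLeft ℓ).toFun g x ∈ linearSpan ℓ ι τ hτ := by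
  induction hg using Subgroup.closure_induction with
  | mem g hg =>
    obtain ⟨a, rfl⟩ | ⟨c, rfl⟩ := hg
    · exact mulLeft_const_mem_linearSpan ℓ ι τ hτ a hx
    · exact mulLeft_linear_mem_linearSpan ℓ ι τ hτ c hx
  | one => simp [SteinbergMap.map_one]
  | mul g h _ _ ihg ihh =>
    rw [SteinbergMap.map_mul, LinearMap.add_apply]
    exact add_mem ihg ihh
  | inv g _ ih =>
    rw [SteinbergMap.map_inv, LinearMap.neg_apply]
    exact neg_mem ih

lemma linearSpan_eq_top (h : splitUnits ι τ hτ = ⊤) : linearSpan ℓ ι τ hτ = ⊤ :=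
  eq_top_iff.2 fun x _ => Total.span_induction ℓ _ (one_mem_linearSpan ℓ ι τ hτ)
    (fun a _ hx => mulLeft_mem_linearSpan ℓ ι τ hτ (h ▸ Subgroup.mem_top a) hx) x

lemma mulLeft_apply_succ {F : Type u} [Field F] (a : Fˣ) (x : Total ℓ F) (m : ℕ) :
    (Total.mulLeft ℓ).toFun a x (m + 1) = unitMul ℓ m a (x m) := by
  have : DirectSum.component ℤ ℕ (fun n => MilnorKMod ℓ F n) (m + 1) ∘ₗ (Total.mulLeft ℓ).toFun a =
      unitMul ℓ m a ∘ₗ DirectSum.component ℤ ℕ (fun n => MilnorKMod ℓ F n) m := by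
    ext n : 1
    refine LinearMap.ext fun y => ?_
    simp only [LinearMap.comp_apply, Total.mulLeft_lof]
    by_cases h : n = m
    · subst h
      simp only [DirectSum.component.lof_self]
    · rw [DirectSum.component.of, DirectSum.component.of, dif_neg h, dif_neg (by lia), map_zero]
  exact LinearMap.congr_fun this x

lemma _root_.Fin.cons_update_comp {α β : Type*} (f : α → β) {m : ℕ} (a : α) (v : Fin m → α)
    (j : Fin m) (b : β) :
    (Fin.cons (f a) (Function.update (fun i => f (v i)) j b) : Fin (m + 1) → β) =
      Function.update (fun i => f ((Fin.cons a v : Fin (m + 1) → α) i)) j.succ b := by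
  rw [Fin.cons_update]
  congr 1
  ext i
  refine Fin.cases ?_ (fun _ => ?_) i <;> rfl

/-- Symbols with at most one nonconstant entry generate `k_m(E)` for `m ≥ 1`, if the units of `E`
are products of constants and linear expressions. -/
lemma hom_ext_of_splitUnits (h : splitUnits ι τ hτ = ⊤) {m : ℕ} (hm : m ≠ 0) {A : Type*}
    [AddCommGroup A] {f g : MilnorKMod ℓ E m →ₗ[ℤ] A}
    (hfg : ∀ (a : Fin m → Kˣ) (j : Fin m) (b : Eˣ),
      f (symbol ℓ (Function.update (fun i => Units.map (ι : K →* E) (a i)) j b)) =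
        g (symbol ℓ (Function.update (fun i => Units.map (ι : K →* E) (a i)) j b))) : f = g := by
  have key : ∀ x, IsLinearSymbol ℓ ι τ hτ x → ∀ (m : ℕ), m ≠ 0 →
      ∀ (f g : MilnorKMod ℓ E m →ₗ[ℤ] A), (∀ (a : Fin m → Kˣ) (j : Fin m) (b : Eˣ),
      f (symbol ℓ (Function.update (fun i => Units.map (ι : K →* E) (a i)) j b)) =
        g (symbol ℓ (Function.update (fun i => Units.map (ι : K →* E) (a i)) j b))) →
      f (x m) = g (x m) := by
    intro x hx
    induction hx with
    | one =>
      intro m hm f g _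
      -- The generator `one` sits in degree `0`, where the hypothesis on `f` and `g` would be empty;
      -- this is why `m ≠ 0` is needed.
      have : (Total.one ℓ : Total ℓ E) m = 0 := DFinsupp.single_eq_of_ne (by lia)
      rw [this, map_zero, map_zero]
    | linear c =>
      intro m hm f g hfg
      obtain ⟨m, rfl⟩ := Nat.exists_eq_succ_of_ne_zero hm
      rw [mulLeft_apply_succ]
      obtain _ | m := m
      · have := hfg (fun _ => 1) 0 (linearUnit ι τ hτ c)
        have h1 : (Total.one ℓ : Total ℓ E) 0 = symbol ℓ Fin.elim0 := DFinsupp.single_eq_same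
        rw [h1, unitMul_symbol]
        convert this using 3 <;> exact funext fun i => Fin.cases rfl (fun j => j.elim0) i
      · have : (Total.one ℓ : Total ℓ E) (m + 1) = 0 := DFinsupp.single_eq_of_ne (by lia)
        rw [this, map_zero, map_zero, map_zero]
    | mul a x _ ih =>
      intro m hm f g hfg
      obtain ⟨m, rfl⟩ := Nat.exists_eq_succ_of_ne_zero hm
      rw [mulLeft_apply_succ]
      obtain _ | m := m
      · have : f ∘ₗ unitMul ℓ 0 (Units.map (ι : K →* E) a) =
            g ∘ₗ unitMul ℓ 0 (Units.map (ι : K →* E) a) := by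
          refine hom_ext fun v => ?_
          have := hfg (fun _ => 1) 0 (Units.map (ι : K →* E) a)
          simp only [LinearMap.comp_apply, unitMul_symbol]
          convert this using 3 <;> exact funext fun i => Fin.cases rfl (fun j => j.elim0) i
        exact LinearMap.congr_fun this _
      -- The leading constant is absorbed into the homomorphisms, which is why the induction
      -- quantifies over `f` and `g`.
      · refine ih (m + 1) (by lia) (f ∘ₗ unitMul ℓ _ (Units.map (ι : K →* E) a))
          (g ∘ₗ unitMul ℓ _ (Units.map (ι : K →* E) a)) fun v j b => ?_
        simp only [LinearMap.comp_apply, unitMul_symbol, Fin.cons_update_comp]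
        exact hfg _ _ _
  have htop := linearSpan_eq_top ℓ ι τ hτ h
  refine LinearMap.ext fun x => ?_
  have hx : DirectSum.lof ℤ ℕ (fun n => MilnorKMod ℓ E n) m x ∈ linearSpan ℓ ι τ hτ :=
    htop ▸ Submodule.mem_top
  have := LinearMap.eqOn_span (s := {x | IsLinearSymbol ℓ ι τ hτ x})
    (f := f ∘ₗ DirectSum.component ℤ ℕ (fun n => MilnorKMod ℓ E n) m)
    (g := g ∘ₗ DirectSum.component ℤ ℕ (fun n => MilnorKMod ℓ E n) m)
    (fun y hy => key y hy m hm f g hfg) hx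
  simpa only [LinearMap.comp_apply, DirectSum.component.lof_self] using this

end Generation

end MilnorKMod

end

/-! ### The signed sum of residues on the projective line -/

noncomputable section

namespace MilnorKMod

section SumResidue

open Polynomial TameDatum

variable (ℓ : ℕ) {L : Type u} [Field L]

lemma ratFuncX_ne_C (c : L) : (RatFunc.X : RatFunc L) ≠ RatFunc.C c := by
  rw [← RatFunc.algebraMap_X, ← RatFunc.algebraMap_C]
  exact fun h => Polynomial.X_ne_C c (RatFunc.algebraMap_injective L h)

lemma linearUnit_eq_polyUnit (c : L) :
    linearUnit RatFunc.C RatFunc.X ratFuncX_ne_C c = polyUnit (X - C c) (X_sub_C_ne_zero c) :=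
  Units.ext (by simp [linearUnit, polyUnit])

lemma map_C_eq_polyUnit (a : Lˣ) :
    Units.map ((RatFunc.C : L →+* RatFunc L) : L →* RatFunc L) a =
      polyUnit (C (a : L)) (C_ne_zero.2 a.ne_zero) :=
  Units.ext (by simp [polyUnit])

lemma residue_atPoint_map_C (c : L) (a : Lˣ) (x : Total ℓ (RatFunc L)) :
    ((atPoint c).residue ℓ ((Total.mulLeft ℓ).toFun
      (Units.map ((RatFunc.C : L →+* RatFunc L) : L →* RatFunc L) a) x)).2 =
      -(Total.mulLeft ℓ).toFun a ((atPoint c).residue ℓ x).2 := by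
  have h := atPoint_polyUnit c (C (a : L)) (C_ne_zero.2 a.ne_zero) (by simp)
  have h2 : (atPoint c).ac (polyUnit (C (a : L)) (C_ne_zero.2 a.ne_zero)) = a :=
    Units.ext (by rw [h.2, eval_C])
  rw [map_C_eq_polyUnit, residue_mulLeft, h.1, h2]
  simp

lemma residue_atInfty_map_C (a : Lˣ) (x : Total ℓ (RatFunc L)) :
    (atInfty.residue ℓ ((Total.mulLeft ℓ).toFun
      (Units.map ((RatFunc.C : L →+* RatFunc L) : L →* RatFunc L) a) x)).2 =
      -(Total.mulLeft ℓ).toFun a (atInfty.residue ℓ x).2 := by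
  have h := atInfty_polyUnit (C (a : L)) (C_ne_zero.2 a.ne_zero)
  have h2 : atInfty.ac (polyUnit (C (a : L)) (C_ne_zero.2 a.ne_zero)) = a :=
    Units.ext (by rw [h.2, leadingCoeff_C])
  rw [map_C_eq_polyUnit, residue_mulLeft, h.1, h2]
  simp

lemma finite_residue_atPoint_ne_zero (x : Total ℓ (RatFunc L)) :
    (Function.support fun c : L => ((atPoint c).residue ℓ x).2).Finite := by
  let N : Submodule ℤ (Total ℓ (RatFunc L)) :=
    { carrier := {x | (Function.support fun c : L => ((atPoint c).residue ℓ x).2).Finite}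
      zero_mem' := by simp
      add_mem' := fun {x y} hx hy => (hx.union hy).subset (by
        simp only [map_add, Prod.snd_add]
        exact Function.support_add _ _)
      smul_mem' := fun k x hx => hx.subset (by
        simp only [map_smul, Prod.smul_snd]
        exact Function.support_const_smul_subset k _) }
  refine Total.span_induction ℓ N ?_ ?_ x
  · simp [N, residue_one]
  · refine fun a x hx => (hx.union (finite_val_atPoint_ne_zero a)).subset fun c hc => ?_
    by_contra h
    simp only [Set.mem_union, Function.mem_support, Set.mem_ofPred_eq, not_or, not_not] at h
    refine hc ?_
    simp [residue_mulLeft, h.1, h.2]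

variable (L) in
/-- The sum of the residues at all rational points of the projective line. -/
def sumResidue : Total ℓ (RatFunc L) →ₗ[ℤ] Total ℓ L :=
  AddMonoidHom.toIntLinearMap <| AddMonoidHom.mk'
    (fun x => (atInfty.residue ℓ x).2 + ∑ᶠ c : L, ((atPoint c).residue ℓ x).2) fun x y => by
      simp only [map_add, Prod.snd_add]
      rw [finsum_add_distrib (finite_residue_atPoint_ne_zero ℓ x)
        (finite_residue_atPoint_ne_zero ℓ y)]
      abel

lemma sumResidue_apply (x : Total ℓ (RatFunc L)) : sumResidue ℓ L x =
    (atInfty.residue ℓ x).2 + ∑ᶠ c : L, ((atPoint c).residue ℓ x).2 := rfl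

lemma sumResidue_map_C (a : Lˣ) (x : Total ℓ (RatFunc L)) :
    sumResidue ℓ L ((Total.mulLeft ℓ).toFun
      (Units.map ((RatFunc.C : L →+* RatFunc L) : L →* RatFunc L) a) x) =
      -(Total.mulLeft ℓ).toFun a (sumResidue ℓ L x) := by
  simp only [sumResidue_apply, residue_atPoint_map_C, residue_atInfty_map_C, map_add,
    finsum_neg_distrib, neg_add,
    map_finsum _ (finite_residue_atPoint_ne_zero ℓ x)]

/-- Away from `c` and infinity `X - c` is a unit, which contributes nothing when `y` is unramified;
infinity is silenced by the vanishing of both components there. At `c` the valuation `1` leaves the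
specialization of `y`. -/
lemma sumResidue_linear (c : L) (y : Total ℓ (RatFunc L)) (hy : (atInfty.residue ℓ y).1 = 0)
    (hy' : (atInfty.residue ℓ y).2 = 0)
    (h : ∀ d, ((atPoint d).residue ℓ y).2 = 0) :
    sumResidue ℓ L ((Total.mulLeft ℓ).toFun (linearUnit RatFunc.C RatFunc.X ratFuncX_ne_C c) y) =
      ((atPoint c).residue ℓ y).1 := by
  rw [sumResidue_apply, finsum_eq_single _ c]
  · simp only [linearUnit_eq_polyUnit, residue_mulLeft, hy, hy', h, (atPoint_X_sub_C_self c).1]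
    simp
  · intro d hd
    have := atPoint_polyUnit d (X - C c) (X_sub_C_ne_zero c) (by simpa [sub_eq_zero] using hd)
    simp [linearUnit_eq_polyUnit, residue_mulLeft, this.1, h]

/-- The sum of the residues at all rational points of the projective line, with a sign which
makes it linear over the Milnor ring of the field of constants. -/
def signedSumResidue : Total ℓ (RatFunc L) →ₗ[ℤ] Total ℓ L := sumResidue ℓ L ∘ₗ Total.sign ℓ _

lemma signedSumResidue_map_C (a : Lˣ) (x : Total ℓ (RatFunc L)) :
    signedSumResidue ℓ ((Total.mulLeft ℓ).toFun
      (Units.map ((RatFunc.C : L →+* RatFunc L) : L →* RatFunc L) a) x) =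
      (Total.mulLeft ℓ).toFun a (signedSumResidue ℓ x) := by
  simp [signedSumResidue, Total.sign_mulLeft, sumResidue_map_C]

lemma signedSumResidue_one : signedSumResidue ℓ (Total.one ℓ : Total ℓ (RatFunc L)) = 0 := by
  simp [signedSumResidue, Total.sign_one, sumResidue_apply, residue_one]

/-- The simple zero at `c` cancels the simple pole at infinity. -/
lemma signedSumResidue_linear_one (c : L) : signedSumResidue ℓ ((Total.mulLeft ℓ).toFun
    (linearUnit RatFunc.C RatFunc.X ratFuncX_ne_C c) (Total.one ℓ)) = 0 := by
  simp only [signedSumResidue, Total.sign_mulLeft, LinearMap.comp_apply, Total.sign_one, map_neg]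
  rw [sumResidue_apply, finsum_eq_single _ c]
  · simp only [linearUnit_eq_polyUnit, residue_mulLeft, residue_one, (atPoint_X_sub_C_self c).1,
      (atInfty_polyUnit _ (X_sub_C_ne_zero c)).1, natDegree_X_sub_C]
    simp
  · intro d hd
    have := atPoint_polyUnit d (X - C c) (X_sub_C_ne_zero c) (by simpa [sub_eq_zero] using hd)
    simp [linearUnit_eq_polyUnit, residue_mulLeft, this.1, residue_one]

/-- Reciprocity for symbols with rational divisors; it lets the sum of residues descend to
`RatQuotient`. -/
lemma linearSpan_le_ker_signedSumResidue :
    linearSpan ℓ (RatFunc.C : L →+* RatFunc L) RatFunc.X ratFuncX_ne_C ≤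
      LinearMap.ker (signedSumResidue ℓ) := by
  refine Submodule.span_le.2 fun x hx => ?_
  induction hx with
  | one => exact signedSumResidue_one ℓ
  | linear c => exact signedSumResidue_linear_one ℓ c
  | mul a x _ ih =>
    simp only [SetLike.mem_coe, LinearMap.mem_ker] at ih ⊢
    rw [signedSumResidue_map_C, ih, map_zero]

variable (p : L[X]) (hmonic : p.Monic) (hdeg : ℓ ∣ p.natDegree) (hroot : ∀ c, p.eval c ≠ 0)

-- Leading coefficient `1` kills the specialization, and the pole order is divisible by `ℓ`.
include hmonic hdeg in
lemma residue_atInfty_monic :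
    atInfty.residue ℓ ((Total.mulLeft ℓ).toFun (polyUnit p hmonic.ne_zero) (Total.one ℓ)) = 0 := by
  have h := atInfty_polyUnit p hmonic.ne_zero
  have h2 : atInfty.ac (polyUnit p hmonic.ne_zero) = 1 :=
    Units.ext (by rw [h.2, hmonic.leadingCoeff, Units.val_one])
  obtain ⟨k, hk⟩ := hdeg
  have h3 : -((p.natDegree : ℕ) : ℤ) • Total.one (F := L) ℓ = 0 := by
    rw [hk, Nat.cast_mul, neg_smul, mul_smul, Total.smul_eq_zero, neg_zero]
  rw [residue_mulLeft, residue_one, h.1, h2]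
  simp [SteinbergMap.map_one, h3]

include hroot in
lemma residue_atPoint_monic (c : L) :
    (atPoint c).residue ℓ ((Total.mulLeft ℓ).toFun (polyUnit p hmonic.ne_zero) (Total.one ℓ)) =
      ((Total.mulLeft ℓ).toFun (Units.mk0 _ (hroot c)) (Total.one ℓ), 0) := by
  have h := atPoint_polyUnit c p hmonic.ne_zero (hroot c)
  have h2 : (atPoint c).ac (polyUnit p hmonic.ne_zero) = Units.mk0 _ (hroot c) :=
    Units.ext h.2
  rw [residue_mulLeft, residue_one, h.1, h2]
  simp

include hdeg hroot in
lemma signedSumResidue_monic :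
    signedSumResidue ℓ ((Total.mulLeft ℓ).toFun (polyUnit p hmonic.ne_zero) (Total.one ℓ)) = 0 := by
  simp only [signedSumResidue, Total.sign_mulLeft, LinearMap.comp_apply, Total.sign_one, map_neg]
  rw [sumResidue_apply, residue_atInfty_monic ℓ p hmonic hdeg]
  simp [residue_atPoint_monic ℓ p hmonic hroot]

-- Only the point `c` contributes, with the specialization `{p(c)}`. For `p` a minimal polynomial
-- this is, up to sign, the norm of a linear element.
include hdeg in
lemma signedSumResidue_linear_monic (c : L) :
    signedSumResidue ℓ ((Total.mulLeft ℓ).toFun (linearUnit RatFunc.C RatFunc.X ratFuncX_ne_C c)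
      ((Total.mulLeft ℓ).toFun (polyUnit p hmonic.ne_zero) (Total.one ℓ))) =
      (Total.mulLeft ℓ).toFun (Units.mk0 _ (hroot c)) (Total.one ℓ) := by
  simp only [signedSumResidue, Total.sign_mulLeft, LinearMap.comp_apply, Total.sign_one, map_neg,
    neg_neg]
  have h1 := residue_atInfty_monic ℓ p hmonic hdeg
  rw [sumResidue_linear ℓ c _ (by rw [h1]; rfl) (by rw [h1]; rfl)
    (by simp [residue_atPoint_monic ℓ p hmonic hroot]), residue_atPoint_monic ℓ p hmonic hroot]

end SumResidue

end MilnorKMod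

end

/-! ### Construction of the transfer in degree `ℓ` -/

noncomputable section

namespace MilnorKMod

section Transfer

open Polynomial TameDatum

lemma _root_.Polynomial.Splits.induction_of_ne_zero {K : Type*} [Field K] {P : K[X] → Prop}
    (hC : ∀ a ≠ 0, P (C a)) (hX : ∀ c, P (X - C c))
    (hmul : ∀ f g : K[X], f ≠ 0 → g ≠ 0 → P f → P g → P (f * g)) {f : K[X]} (hf : f.Splits)
    (h0 : f ≠ 0) : P f := by
  induction hf using Submonoid.closure_induction with
  | mem f hf =>
    obtain ⟨a, rfl⟩ | ⟨a, rfl⟩ := hf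
    · exact hC a (by rintro rfl; simp at h0)
    · simpa using hX (-a)
  | one => simpa using hC 1 one_ne_zero
  | mul f g _ _ ihf ihg =>
    have h1 := left_ne_zero_of_mul h0
    have h2 := right_ne_zero_of_mul h0
    exact hmul f g h1 h2 (ihf h1) (ihg h2)

variable {L M : Type u} [Field L] [Field M] [Algebra L M] (pb : PowerBasis L M)

/-- The minimal polynomial of a generator is the characteristic polynomial of multiplication by it.
-/
lemma norm_algebraMap_sub_gen (c : L) :
    Algebra.norm L (algebraMap L M c - pb.gen) = (minpoly L pb.gen).eval c := by
  have := pb.finite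
  rw [← charpoly_leftMulMatrix, Matrix.eval_charpoly, Algebra.norm_eq_matrix_det pb.basis, map_sub,
    AlgHom.commutes]
  rfl

lemma exists_rep (b : Mˣ) : ∃ q : L[X], q.natDegree < pb.dim ∧ aeval pb.gen q = b := by
  obtain ⟨q, hq, h⟩ := pb.exists_eq_aeval (b : M)
  exact ⟨q, hq, h.symm⟩

/-- The polynomial of minimal degree which represents an element of a simple extension. -/
def rep (b : Mˣ) : L[X] := (exists_rep pb b).choose

lemma natDegree_rep_lt (b : Mˣ) : (rep pb b).natDegree < pb.dim := (exists_rep pb b).choose_spec.1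

lemma aeval_rep (b : Mˣ) : aeval pb.gen (rep pb b) = b := (exists_rep pb b).choose_spec.2

lemma rep_ne_zero (b : Mˣ) : rep pb b ≠ 0 := fun h =>
  b.ne_zero (by rw [← aeval_rep pb, h, map_zero])

lemma eq_of_aeval_eq {p q : L[X]} (hp : p.natDegree < pb.dim) (hq : q.natDegree < pb.dim)
    (h : aeval pb.gen p = aeval pb.gen q) : p = q := by
  by_contra hne
  have := pb.dim_le_natDegree_of_root (sub_ne_zero.2 hne) (by rw [map_sub, h, sub_self])
  have := natDegree_sub_le p q
  lia

lemma rep_eq {b : Mˣ} {q : L[X]} (hq : q.natDegree < pb.dim) (h : aeval pb.gen q = b) :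
    rep pb b = q :=
  eq_of_aeval_eq pb (natDegree_rep_lt pb b) hq (by rw [aeval_rep, h])

lemma gen_ne_algebraMap (hdim : pb.dim ≠ 1) (c : L) : pb.gen ≠ algebraMap L M c := by
  intro h
  have := pb.dim_le_natDegree_of_root (X_sub_C_ne_zero c) (by simp [h])
  rw [natDegree_X_sub_C] at this
  have := pb.dim_pos
  lia

lemma splitUnits_gen_eq_top (hdim : pb.dim ≠ 1)
    (hsplit : ∀ q : L[X], q.natDegree < pb.dim → q.Splits) :
    splitUnits (algebraMap L M) pb.gen (gen_ne_algebraMap pb hdim) = ⊤ := by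
  refine eq_top_iff.2 fun b _ => ?_
  have := (hsplit _ (natDegree_rep_lt pb b)).induction_of_ne_zero
    (P := fun f => ∀ b : Mˣ, aeval pb.gen f = b →
      b ∈ splitUnits (algebraMap L M) pb.gen (gen_ne_algebraMap pb hdim)) ?_ ?_ ?_
      (rep_ne_zero pb b)
  · exact this b (aeval_rep pb b)
  · intro a ha b hb
    exact Subgroup.subset_closure (.inl ⟨Units.mk0 a ha, Units.ext (by simpa using hb)⟩)
  · intro c b hb
    exact Subgroup.subset_closure (.inr ⟨c, Units.ext (by simpa [linearUnit] using hb)⟩)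
  · intro f g _ _ hf hg b hb
    rw [map_mul] at hb
    have h1 : aeval pb.gen f ≠ 0 := left_ne_zero_of_mul (hb ▸ b.ne_zero)
    have h2 : aeval pb.gen g ≠ 0 := right_ne_zero_of_mul (hb ▸ b.ne_zero)
    have : b = Units.mk0 _ h1 * Units.mk0 _ h2 := Units.ext hb.symm
    rw [this]
    exact mul_mem (hf _ rfl) (hg _ rfl)

variable (L) in
/-- The group of rational functions with only rational zeros and poles. -/
abbrev ratSplitUnits : Subgroup (RatFunc L)ˣ :=
  splitUnits (RatFunc.C : L →+* RatFunc L) RatFunc.X ratFuncX_ne_C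

lemma polyUnit_mem_ratSplitUnits {q : L[X]} (hq : q ≠ 0) (h : q.Splits) :
    polyUnit q hq ∈ ratSplitUnits L := by
  have := h.induction_of_ne_zero (P := fun f => ∀ hf : f ≠ 0, polyUnit f hf ∈ ratSplitUnits L)
    ?_ ?_ ?_ hq
  · exact this hq
  · intro a ha _
    exact Subgroup.subset_closure (.inl ⟨Units.mk0 a ha, map_C_eq_polyUnit _⟩)
  · intro c _
    exact Subgroup.subset_closure (.inr ⟨c, linearUnit_eq_polyUnit _⟩)
  · intro f g hf hg h1 h2 _
    rw [polyUnit_mul f g hf hg]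
    exact mul_mem (h1 hf) (h2 hg)

variable (ℓ : ℕ)

variable (L) in
/-- The Milnor ring of the rational function field modulo symbols with rational divisors. -/
abbrev RatQuotient : Type u :=
  Total ℓ (RatFunc L) ⧸ linearSpan ℓ (RatFunc.C : L →+* RatFunc L) RatFunc.X ratFuncX_ne_C

/-- The action of the rational functions with rational divisors. -/
def ratAction (g : ratSplitUnits L) : Module.End ℤ (RatQuotient L ℓ) :=
  Submodule.mapQ _ _ ((Total.mulLeft ℓ).toFun g.1) fun _ hx =>
    mulLeft_mem_linearSpan ℓ _ _ _ g.2 hx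

lemma ratAction_mk (g : ratSplitUnits L) (x : Total ℓ (RatFunc L)) :
    ratAction ℓ g (Submodule.Quotient.mk x) =
      Submodule.Quotient.mk ((Total.mulLeft ℓ).toFun g.1 x) := rfl

lemma ratAction_mul (g h : ratSplitUnits L) :
    ratAction ℓ (g * h) = ratAction ℓ g + ratAction ℓ h := by
  refine LinearMap.ext fun z => ?_
  induction z using Submodule.Quotient.induction_on with
  | _ x =>
    rw [LinearMap.add_apply, ratAction_mk, ratAction_mk, ratAction_mk, Subgroup.coe_mul,
      SteinbergMap.map_mul]
    rfl

lemma ratAction_anticomm (g h : ratSplitUnits L) (z : RatQuotient L ℓ) :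
    ratAction ℓ g (ratAction ℓ h z) = -ratAction ℓ h (ratAction ℓ g z) := by
  induction z using Submodule.Quotient.induction_on with
  | _ x =>
    rw [ratAction_mk, ratAction_mk, ratAction_mk, ratAction_mk, ← Module.End.mul_apply,
      SteinbergMap.anticomm]
    rfl

variable (hsplit : ∀ q : L[X], q.natDegree < pb.dim → q.Splits)

/-- The representing polynomial as a rational function with rational divisor. -/
def repUnit (b : Mˣ) : ratSplitUnits L :=
  ⟨polyUnit (rep pb b) (rep_ne_zero pb b),
    polyUnit_mem_ratSplitUnits _ (hsplit _ (natDegree_rep_lt pb b))⟩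

/-- The part of the quotient on which the action of representing polynomials is multiplicative. -/
def multiplicativePart : Submodule ℤ (RatQuotient L ℓ) :=
  ⨅ (b : Mˣ) (c : Mˣ), LinearMap.ker (ratAction ℓ
    (repUnit pb hsplit b * repUnit pb hsplit c * (repUnit pb hsplit (b * c))⁻¹))

lemma mem_multiplicativePart {z : RatQuotient L ℓ} : z ∈ multiplicativePart pb ℓ hsplit ↔
    ∀ b c : Mˣ, ratAction ℓ
      (repUnit pb hsplit b * repUnit pb hsplit c * (repUnit pb hsplit (b * c))⁻¹) z = 0 := by
  simp only [multiplicativePart, Submodule.mem_iInf, LinearMap.mem_ker]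

/-- The defining operators anticommute with the action, so their common kernel is stable. -/
lemma ratAction_mem_multiplicativePart (g : ratSplitUnits L) {z : RatQuotient L ℓ}
    (hz : z ∈ multiplicativePart pb ℓ hsplit) :
    ratAction ℓ g z ∈ multiplicativePart pb ℓ hsplit := by
  rw [mem_multiplicativePart] at hz ⊢
  intro b c
  rw [ratAction_anticomm, hz, map_zero, neg_zero]

/-- The action of the units of a simple extension through their representing polynomials. -/
def repAction : SteinbergMap M (Module.End ℤ (multiplicativePart pb ℓ hsplit)) where
  toFun b := (ratAction ℓ (repUnit pb hsplit b)).restrict fun _ hz =>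
    ratAction_mem_multiplicativePart pb ℓ hsplit _ hz
  map_mul b c := by
    refine LinearMap.ext fun z => Subtype.ext ?_
    have h := (mem_multiplicativePart pb ℓ hsplit).1 z.2 b c
    have h2 := ratAction_mul ℓ (repUnit pb hsplit b * repUnit pb hsplit c *
      (repUnit pb hsplit (b * c))⁻¹) (repUnit pb hsplit (b * c))
    rw [inv_mul_cancel_right] at h2
    have h3 := LinearMap.congr_fun h2 z.1
    rw [LinearMap.add_apply, h, zero_add, ratAction_mul] at h3
    exact h3.symm
  steinberg b c h := by
    refine LinearMap.ext fun z => Subtype.ext ?_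
    -- Representatives have degree below `pb.dim`, so they add without reduction and the Steinberg
    -- relation lifts to polynomials.
    have hrep : rep pb b + rep pb c = 1 := by
      refine eq_of_aeval_eq pb ?_ (by simpa using pb.dim_pos) ?_
      · exact (natDegree_add_le _ _).trans_lt
          (max_lt (natDegree_rep_lt pb b) (natDegree_rep_lt pb c))
      · rw [map_add, aeval_rep, aeval_rep, h, map_one]
    have := (Total.mulLeft (F := RatFunc L) ℓ).steinberg (repUnit pb hsplit b).1
      (repUnit pb hsplit c).1 (by
        simp only [repUnit, polyUnit, Units.val_mk0]
        rw [← map_add, hrep, map_one])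
    obtain ⟨z, hz⟩ := z
    change ratAction ℓ _ (ratAction ℓ _ z) = 0
    induction z using Submodule.Quotient.induction_on with
    | _ x =>
      rw [ratAction_mk, ratAction_mk, ← Module.End.mul_apply, this]
      rfl

/-- The minimal polynomial of the generator as a rational function. -/
def minpolyUnit : (RatFunc L)ˣ :=
  polyUnit (minpoly L pb.gen) (minpoly.monic pb.isIntegral_gen).ne_zero

/-- The class of the symbol of the minimal polynomial. -/
def minpolySymbol : RatQuotient L ℓ :=
  Submodule.Quotient.mk ((Total.mulLeft ℓ).toFun (minpolyUnit pb) (Total.one ℓ))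

/-- With `f_b f_c = f_{bc} + π g`, the function `q = f_b f_c / f_{bc}` satisfies `q + π w = 1` for
`w = -g / f_{bc}`. Hence `{q, π} = -{q, w}`, a symbol of functions with rational divisors. -/
lemma minpolySymbol_mem : minpolySymbol pb ℓ ∈ multiplicativePart pb ℓ hsplit := by
  rw [mem_multiplicativePart]
  intro b c
  have hmon := minpoly.monic pb.isIntegral_gen
  let q := repUnit pb hsplit b * repUnit pb hsplit c * (repUnit pb hsplit (b * c))⁻¹
  let g := rep pb b * rep pb c /ₘ minpoly L pb.gen
  have hg : rep pb b * rep pb c = rep pb (b * c) + minpoly L pb.gen * g := by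
    rw [rep_eq pb (b := b * c) (q := rep pb b * rep pb c %ₘ minpoly L pb.gen),
      modByMonic_add_div]
    · rw [← pb.natDegree_minpoly]
      exact natDegree_modByMonic_lt _ hmon (fun h => by
        have := pb.dim_pos
        rw [← pb.natDegree_minpoly, h, natDegree_one] at this
        lia)
    · rw [aeval_modByMonic_eq_self_of_root (minpoly.aeval L pb.gen), map_mul, aeval_rep,
        aeval_rep, Units.val_mul]
  change ratAction ℓ q _ = 0
  have hR (b : Mˣ) : algebraMap L[X] (RatFunc L) (rep pb b) ≠ 0 := by
    simpa using rep_ne_zero pb b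
  have hq : (q.1 : RatFunc L) = algebraMap L[X] (RatFunc L) (rep pb b * rep pb c) /
      algebraMap L[X] (RatFunc L) (rep pb (b * c)) := by
    simp [q, repUnit, polyUnit, div_eq_mul_inv]
  by_cases hg0 : g = 0
  · have : q = 1 := by
      refine Subtype.ext (Units.ext ?_)
      rw [hq, hg, hg0, mul_zero, add_zero, div_self (hR _)]
      rfl
    rw [minpolySymbol, ratAction_mk, this]
    simp [SteinbergMap.map_one]
  -- The quotient has degree at most `2(d - 1) - d < d`, where `d = pb.dim`, so it splits.
  · have hgs : polyUnit g hg0 ∈ ratSplitUnits L := by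
      refine polyUnit_mem_ratSplitUnits hg0 (hsplit g ?_)
      rw [natDegree_divByMonic _ hmon, pb.natDegree_minpoly]
      have := natDegree_rep_lt pb b
      have := natDegree_rep_lt pb c
      have := natDegree_mul_le (p := rep pb b) (q := rep pb c)
      lia
    have hneg : (-1 : (RatFunc L)ˣ) ∈ ratSplitUnits L :=
      Subgroup.subset_closure (.inl ⟨-1, Units.ext (by simp)⟩)
    let w : ratSplitUnits L := ⟨-1, hneg⟩ * ⟨polyUnit g hg0, hgs⟩ * (repUnit pb hsplit (b * c))⁻¹
    have hsum : (q.1 : RatFunc L) + ((minpolyUnit pb * w.1 : (RatFunc L)ˣ) : RatFunc L) = 1 := by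
      have hw : ((minpolyUnit pb * w.1 : (RatFunc L)ˣ) : RatFunc L) =
          -(algebraMap L[X] (RatFunc L) (minpoly L pb.gen * g) /
            algebraMap L[X] (RatFunc L) (rep pb (b * c))) := by
        simp [w, minpolyUnit, repUnit, polyUnit, div_eq_mul_inv]
        ring
      rw [hq, hw, hg, map_add, add_div, div_self (hR _), add_neg_cancel_right]
    have h := LinearMap.congr_fun ((Total.mulLeft (F := RatFunc L) ℓ).steinberg _ _ hsum)
      (Total.one ℓ)
    rw [SteinbergMap.map_mul, mul_add, LinearMap.add_apply, LinearMap.zero_apply,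
      Module.End.mul_apply] at h
    rw [minpolySymbol, ratAction_mk, eq_neg_of_add_eq_zero_left h, Submodule.Quotient.mk_eq_zero,
      Module.End.mul_apply]
    exact neg_mem (mulLeft_mem_linearSpan ℓ _ _ _ q.2 (mulLeft_mem_linearSpan ℓ _ _ _ w.2
      (one_mem_linearSpan ℓ _ _ _)))

/-- The homomorphism which sends `{f₁(α), …, fₘ(α)}` to the class of `{f₁, …, fₘ, π}`, where
`π` is the minimal polynomial of `α`. -/
def repSymbol : Total ℓ M →ₗ[ℤ] RatQuotient L ℓ :=
  (multiplicativePart pb ℓ hsplit).subtype ∘ₗ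
    Total.lift ℓ (repAction pb ℓ hsplit) ⟨_, minpolySymbol_mem pb ℓ hsplit⟩
      (Subtype.ext (by
        change (ℓ : ℤ) • minpolySymbol pb ℓ = 0
        rw [minpolySymbol, ← Submodule.Quotient.mk_smul, Total.smul_eq_zero]
        rfl))

lemma repSymbol_one : repSymbol pb ℓ hsplit (Total.one ℓ) = minpolySymbol pb ℓ := by
  rw [repSymbol, LinearMap.comp_apply, Total.lift_one]
  rfl

lemma repSymbol_mulLeft (b : Mˣ) (x : Total ℓ M) :
    repSymbol pb ℓ hsplit ((Total.mulLeft ℓ).toFun b x) =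
      ratAction ℓ (repUnit pb hsplit b) (repSymbol pb ℓ hsplit x) := by
  rw [repSymbol, LinearMap.comp_apply, Total.lift_mulLeft]
  rfl

/-- The signed sum of residues on the quotient. -/
def quotientResidue : RatQuotient L ℓ →ₗ[ℤ] Total ℓ L :=
  Submodule.liftQ _ (signedSumResidue ℓ) (linearSpan_le_ker_signedSumResidue ℓ)

/-- The transfer on Milnor rings modulo `ℓ`. -/
def totalTransfer : Total ℓ M →ₗ[ℤ] Total ℓ L := quotientResidue ℓ ∘ₗ repSymbol pb ℓ hsplit

lemma totalTransfer_mulLeft_unitIncl (a : Lˣ) (x : Total ℓ M) :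
    totalTransfer pb ℓ hsplit ((Total.mulLeft ℓ).toFun (unitIncl L M a) x) =
      (Total.mulLeft ℓ).toFun a (totalTransfer pb ℓ hsplit x) := by
  have hrep : rep pb (unitIncl L M a) = C (a : L) :=
    rep_eq pb (by simpa using pb.dim_pos) (by simp)
  have hu : (repUnit pb hsplit (unitIncl L M a)).1 =
      Units.map ((RatFunc.C : L →+* RatFunc L) : L →* RatFunc L) a :=
    Units.ext (by simp [repUnit, polyUnit, hrep])
  rw [totalTransfer, LinearMap.comp_apply, LinearMap.comp_apply, repSymbol_mulLeft]
  generalize repSymbol pb ℓ hsplit x = z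
  induction z using Submodule.Quotient.induction_on with
  | _ y =>
    rw [ratAction_mk, hu]
    exact signedSumResidue_map_C ℓ a y

lemma minpoly_eval_ne_zero (hdim : pb.dim ≠ 1) (c : L) : (minpoly L pb.gen).eval c ≠ 0 := by
  have := pb.finite
  rw [← norm_algebraMap_sub_gen, Algebra.norm_ne_zero_iff, sub_ne_zero]
  exact (gen_ne_algebraMap pb hdim c).symm

variable {ℓ} (hℓ : ℓ.Prime) (hdim : pb.dim = ℓ)

-- Both sides are additive in `b`, so constants and linear elements suffice. For a constant the norm
-- is an `ℓ`-th power and both sides vanish. For `α - c` the norm is `(-1)^ℓ π(c)`, whose sign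
-- factor has trivial class modulo `ℓ`.
include hdim hℓ in
lemma totalTransfer_mulLeft_one (b : Mˣ) :
    totalTransfer pb ℓ hsplit ((Total.mulLeft ℓ).toFun b (Total.one ℓ)) =
      (Total.mulLeft ℓ).toFun (unitNorm L M b) (Total.one ℓ) := by
  have hdim1 : pb.dim ≠ 1 := hdim ▸ hℓ.one_lt.ne'
  have hmon := minpoly.monic pb.isIntegral_gen
  have hdvd : ℓ ∣ (minpoly L pb.gen).natDegree := by rw [pb.natDegree_minpoly, hdim]
  have hfin : Module.finrank L M = ℓ := by rw [pb.finrank, hdim]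
  rw [totalTransfer, LinearMap.comp_apply, repSymbol_mulLeft, repSymbol_one]
  change signedSumResidue ℓ ((Total.mulLeft ℓ).toFun (polyUnit (rep pb b) (rep_ne_zero pb b))
    ((Total.mulLeft ℓ).toFun (minpolyUnit pb) (Total.one ℓ))) = _
  have := (hsplit _ (natDegree_rep_lt pb b)).induction_of_ne_zero
    (P := fun f => ∀ (hf : f ≠ 0) (b : Mˣ), aeval pb.gen f = b →
      signedSumResidue ℓ ((Total.mulLeft ℓ).toFun (polyUnit f hf)
        ((Total.mulLeft ℓ).toFun (minpolyUnit pb) (Total.one ℓ))) =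
      (Total.mulLeft ℓ).toFun (unitNorm L M b) (Total.one ℓ)) ?_ ?_ ?_ (rep_ne_zero pb b)
  · exact this _ b (aeval_rep pb b)
  · intro a ha hf b hb
    have h1 : polyUnit (C a) hf =
        Units.map ((RatFunc.C : L →+* RatFunc L) : L →* RatFunc L) (Units.mk0 a ha) :=
      (map_C_eq_polyUnit (Units.mk0 a ha)).symm
    have h2 : unitNorm L M b = Units.mk0 a ha ^ ℓ := by
      refine Units.ext ?_
      rw [Units.coe_map, ← hb, aeval_C, Algebra.norm_algebraMap, hfin]
      simp
    rw [h1, h2, signedSumResidue_map_C, minpolyUnit,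
      signedSumResidue_monic ℓ _ hmon hdvd (minpoly_eval_ne_zero pb hdim1), map_zero,
      SteinbergMap.map_pow, ← natCast_zsmul, LinearMap.smul_apply, Total.smul_eq_zero]
  · intro c hf b hb
    have h1 : polyUnit (X - C c) hf = linearUnit RatFunc.C RatFunc.X ratFuncX_ne_C c :=
      (linearUnit_eq_polyUnit c).symm
    have h2 : unitNorm L M b = (-1) ^ ℓ *
        Units.mk0 _ (minpoly_eval_ne_zero pb hdim1 c) := by
      refine Units.ext ?_
      rw [Units.coe_map, ← hb]
      simp only [map_sub, aeval_X, aeval_C, Units.val_mul, Units.val_pow_eq_pow_val, Units.val_neg,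
        Units.val_one, Units.val_mk0]
      rw [← norm_algebraMap_sub_gen, ← hfin, ← Algebra.norm_algebraMap (S := M), ← map_mul]
      simp
    rw [h1, minpolyUnit, signedSumResidue_linear_monic ℓ _ hmon hdvd
      (minpoly_eval_ne_zero pb hdim1), h2, SteinbergMap.map_mul, SteinbergMap.map_pow,
      ← natCast_zsmul, LinearMap.add_apply, LinearMap.smul_apply, Total.smul_eq_zero, zero_add]
  · intro f g hf hg ihf ihg hfg b hb
    rw [map_mul] at hb
    have h1 : aeval pb.gen f ≠ 0 := left_ne_zero_of_mul (hb ▸ b.ne_zero)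
    have h2 : aeval pb.gen g ≠ 0 := right_ne_zero_of_mul (hb ▸ b.ne_zero)
    have : b = Units.mk0 _ h1 * Units.mk0 _ h2 := Units.ext hb.symm
    rw [this, map_mul, SteinbergMap.map_mul, LinearMap.add_apply,
      ← ihf hf (Units.mk0 _ h1) rfl, ← ihg hg (Units.mk0 _ h2) rfl, ← map_add,
      ← LinearMap.add_apply, ← SteinbergMap.map_mul, polyUnit_mul f g hf hg]

lemma lof_symbol_cons {F : Type u} [Field F] {m : ℕ} (a : Fˣ) (v : Fin m → Fˣ) :
    DirectSum.lof ℤ ℕ (fun n => MilnorKMod ℓ F n) (m + 1)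
      (symbol ℓ (Fin.cons a v : Fin (m + 1) → Fˣ)) =
    (Total.mulLeft ℓ).toFun a (DirectSum.lof ℤ ℕ (fun n => MilnorKMod ℓ F n) m (symbol ℓ v)) := by
  rw [Total.mulLeft_lof, unitMul_symbol]

lemma _root_.Fin.comp_eq_cons {α β : Type*} (f : α → β) {m : ℕ} (v : Fin (m + 1) → α) :
    (fun i => f (v i)) =
      (Fin.cons (f (v 0)) (fun i : Fin m => f (v i.succ)) : Fin (m + 1) → β) := by
  ext i
  refine Fin.cases ?_ (fun _ => ?_) i <;> rfl

lemma _root_.Fin.update_zero_eq_cons {β : Type*} {m : ℕ} (v : Fin (m + 1) → β) (b : β) :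
    Function.update v 0 b = (Fin.cons b (fun i : Fin m => v i.succ) : Fin (m + 1) → β) := by
  ext i
  refine Fin.cases ?_ (fun _ => ?_) i
  · simp
  · simp

lemma _root_.Fin.update_succ_eq_cons {β : Type*} {m : ℕ} (v : Fin (m + 1) → β) (j : Fin m) (b : β) :
    Function.update v j.succ b =
      (Fin.cons (v 0) (Function.update (fun i : Fin m => v i.succ) j b) : Fin (m + 1) → β) := by
  rw [Fin.cons_update]
  congr 1
  exact (Fin.cons_self_tail v).symm

-- The totalTransfer is linear only for constants on the left, so each constant is moved in front of
-- `b` by anticommutativity and back again afterwards.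
include hdim hℓ in
lemma totalTransfer_mulLeft_symbol {m : ℕ} (b : Mˣ) (v : Fin m → Lˣ) :
    totalTransfer pb ℓ hsplit ((Total.mulLeft ℓ).toFun b
      (DirectSum.lof ℤ ℕ (fun n => MilnorKMod ℓ M n) m (symbol ℓ fun i => unitIncl L M (v i)))) =
    (Total.mulLeft ℓ).toFun (unitNorm L M b)
      (DirectSum.lof ℤ ℕ (fun n => MilnorKMod ℓ L n) m (symbol ℓ v)) := by
  induction m with
  | zero =>
    have := totalTransfer_mulLeft_one pb hsplit hℓ hdim b
    rw [Subsingleton.elim (fun i => unitIncl L M (v i)) Fin.elim0, Subsingleton.elim v Fin.elim0]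
    exact this
  | succ m ih =>
    rw [Fin.comp_eq_cons, lof_symbol_cons, ← Module.End.mul_apply, SteinbergMap.anticomm,
      LinearMap.neg_apply, Module.End.mul_apply, map_neg, totalTransfer_mulLeft_unitIncl, ih,
      ← Module.End.mul_apply, ← LinearMap.neg_apply, ← SteinbergMap.anticomm, Module.End.mul_apply,
      ← lof_symbol_cons]
    congr 4
    exact Fin.cons_self_tail v

include hdim hℓ in
lemma totalTransfer_symbol_update {m : ℕ} (a : Fin m → Lˣ) (j : Fin m) (b : Mˣ) :
    totalTransfer pb ℓ hsplit (DirectSum.lof ℤ ℕ (fun n => MilnorKMod ℓ M n) m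
      (symbol ℓ (Function.update (fun i => unitIncl L M (a i)) j b))) =
    DirectSum.lof ℤ ℕ (fun n => MilnorKMod ℓ L n) m
      (symbol ℓ (Function.update a j (unitNorm L M b))) := by
  induction m with
  | zero => exact j.elim0
  | succ m ih =>
    induction j using Fin.cases with
    | zero =>
      rw [Fin.update_zero_eq_cons, Fin.update_zero_eq_cons, lof_symbol_cons, lof_symbol_cons]
      exact totalTransfer_mulLeft_symbol pb hsplit hℓ hdim b fun i => a i.succ
    | succ j =>
      rw [Fin.update_succ_eq_cons, Fin.update_succ_eq_cons, lof_symbol_cons, lof_symbol_cons,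
        totalTransfer_mulLeft_unitIncl, ih fun i => a i.succ]

include hℓ hdim hsplit in
/-- The transfer exists. -/
theorem exists_isTransfer {m : ℕ} (hm : m ≠ 0) : ∃ T, IsTransfer ℓ m L M T := by
  have hdim1 : pb.dim ≠ 1 := hdim ▸ hℓ.one_lt.ne'
  have hfin : Module.finrank L M = ℓ := by rw [pb.finrank, hdim]
  let T : MilnorKMod ℓ M m →ₗ[ℤ] MilnorKMod ℓ L m :=
    DirectSum.component ℤ ℕ (fun n => MilnorKMod ℓ L n) m ∘ₗ totalTransfer pb ℓ hsplit ∘ₗ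
      DirectSum.lof ℤ ℕ (fun n => MilnorKMod ℓ M n) m
  have hT (a : Fin m → Lˣ) (j : Fin m) (b : Mˣ) :
      T (symbol ℓ (Function.update (fun i => unitIncl L M (a i)) j b)) =
      symbol ℓ (Function.update a j (unitNorm L M b)) := by
    simp only [T, LinearMap.comp_apply, totalTransfer_symbol_update pb hsplit hℓ hdim,
      DirectSum.component.lof_self]
  refine ⟨T, ?_, hT, fun σ => ?_⟩
  · intro a
    obtain ⟨m, rfl⟩ := Nat.exists_eq_succ_of_ne_zero hm
    -- Both sides vanish: the degree is `ℓ`, and the norm of the constant `a 0` is its `ℓ`-th power.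
    -- A zeroth entry exists because `m ≠ 0`.
    have h := hT a 0 (unitIncl L M (a 0))
    rw [Function.update_eq_self_iff.2 rfl] at h
    have h2 : unitNorm L M (unitIncl L M (a 0)) = a 0 ^ ℓ :=
      Units.ext (by simp [Algebra.norm_algebraMap, hfin])
    rw [h, hfin, smul_eq_zero, h2, Fin.update_zero_eq_cons]
    have h3 := (Total.mulLeft ℓ).map_pow (a 0) ℓ
    have h4 := LinearMap.congr_fun h3
      (DirectSum.lof ℤ ℕ (fun n => MilnorKMod ℓ L n) m (symbol ℓ fun i => a i.succ))
    rw [← lof_symbol_cons, ← natCast_zsmul, LinearMap.smul_apply, Total.smul_eq_zero] at h4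
    have h5 := congrArg (DirectSum.component ℤ ℕ (fun n => MilnorKMod ℓ L n) (m + 1)) h4
    rwa [DirectSum.component.lof_self, map_zero] at h5
  -- Galois invariance is checked on generators, where it is the invariance of the norm.
  · refine hom_ext_of_splitUnits ℓ (algebraMap L M) pb.gen (gen_ne_algebraMap pb hdim1)
      (splitUnits_gen_eq_top pb hdim1 hsplit) hm fun a j b => ?_
    have h1 : galoisRep ℓ m L M σ (symbol ℓ (Function.update
        (fun i => Units.map (algebraMap L M : L →* M) (a i)) j b)) =
        symbol ℓ (Function.update (fun i => unitIncl L M (a i)) j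
          (Units.map ((σ : M →+* M) : M →* M) b)) := by
      change map ℓ m (σ : M →+* M) _ = _
      rw [map_symbol]
      congr 1
      ext i
      by_cases hi : i = j
      · subst hi; simp
      · simp [hi]
    rw [LinearMap.comp_apply, h1, hT]
    refine (congrArg (symbol ℓ) ?_).trans (hT a j b).symm
    congr 1
    exact Units.ext (Algebra.norm_eq_of_algEquiv σ _)

end Transfer

end MilnorKMod

end

/-! ### Fields without extensions of degree prime to `ℓ` -/

noncomputable section

namespace MilnorKMod

open Polynomial

/-- The characteristic of `F` is not `ℓ` and `F` has no nontrivial finite extensions of degree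
prime to `ℓ`. -/
structure IsSpecialField (ℓ : ℕ) (F : Type u) [Field F] : Prop where
  ringChar_ne : ringChar F ≠ ℓ
  finrank_eq_one : ∀ (E : Type u) [Field E] [Algebra F E], FiniteDimensional F E →
    (Module.finrank F E).Coprime ℓ → Module.finrank F E = 1

namespace IsSpecialField

variable {ℓ : ℕ} (hℓ : ℓ.Prime) {F : Type u} [Field F] (hF : IsSpecialField ℓ F)

include hF in
lemma natDegree_eq_one {q : F[X]} (hq : Irreducible q) (hc : q.natDegree.Coprime ℓ) :
    q.natDegree = 1 := by
  have := Fact.mk hq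
  have hfin : Module.finrank F (AdjoinRoot q) = q.natDegree := by
    rw [(AdjoinRoot.powerBasis hq.ne_zero).finrank, AdjoinRoot.powerBasis_dim]
  rw [← hfin]
  exact hF.finrank_eq_one (AdjoinRoot q) (AdjoinRoot.powerBasis hq.ne_zero).finite (by rwa [hfin])

-- Irreducible factors have degree below `ℓ`, hence prime to `ℓ`, hence `1`.
include hℓ hF in
lemma splits_of_natDegree_lt {q : F[X]} (hq : q.natDegree < ℓ) : q.Splits := by
  by_cases h0 : q = 0
  · simp [h0]
  obtain ⟨u, hu⟩ := UniqueFactorizationMonoid.factors_prod h0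
  rw [← hu]
  refine (Splits.multisetProd fun g hg => ?_).mul u.isUnit.splits
  have hirr := UniqueFactorizationMonoid.irreducible_of_factor g hg
  refine Splits.of_natDegree_eq_one (hF.natDegree_eq_one hirr ?_)
  have hle := natDegree_le_of_dvd (UniqueFactorizationMonoid.dvd_of_mem_factors hg) h0
  exact (Nat.coprime_of_lt_prime hirr.natDegree_pos.ne' (hle.trans_lt hq) hℓ).symm

-- In characteristic `p ≠ ℓ`, an element `y` without a `p`-th root would make `X ^ p - y`
-- irreducible of degree prime to `ℓ`.
include hℓ hF in
lemma perfectField : PerfectField F := by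
  obtain ⟨p, hp⟩ := CharP.exists F
  rcases CharP.char_is_prime_or_zero F p with h | rfl
  · have := Fact.mk h
    have : ExpChar F p := ExpChar.prime h
    have : PerfectRing F p := PerfectRing.ofSurjective F p fun y => by
      by_contra! hy
      have hirr := X_pow_sub_C_irreducible_of_prime h hy
      have := hF.natDegree_eq_one hirr (by
        rw [natDegree_X_pow_sub_C, Nat.coprime_primes h hℓ]
        rintro rfl
        exact hF.ringChar_ne (ringChar.eq F p))
      rw [natDegree_X_pow_sub_C] at this
      exact h.one_lt.ne' this
    exact PerfectRing.toPerfectField F p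
  · have := CharP.charP_to_charZero F
    infer_instance

-- The fixed field of a Sylow `ℓ`-subgroup has degree prime to `ℓ` over `F`, so the subgroup is
-- everything.
include hℓ hF in
lemma exists_card_aut_eq_pow (N : Type u) [Field N] [Algebra F N] [FiniteDimensional F N]
    [IsGalois F N] : ∃ k, Nat.card Gal(N/F) = ℓ ^ k := by
  have := Fact.mk hℓ
  obtain ⟨P⟩ : Nonempty (Sylow ℓ Gal(N/F)) := inferInstance
  have hidx : (P : Subgroup Gal(N/F)).index = 1 := by
    have h1 := IntermediateField.finrank_eq_fixingSubgroup_index N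
      (IntermediateField.fixedField (P : Subgroup Gal(N/F)))
    rw [IntermediateField.fixingSubgroup_fixedField] at h1
    rw [← h1]
    refine hF.finrank_eq_one (IntermediateField.fixedField (P : Subgroup Gal(N/F)))
      inferInstance ?_
    rw [h1]
    exact ((Nat.Prime.coprime_iff_not_dvd hℓ).2 P.not_dvd_index).symm
  obtain ⟨k, hk⟩ := IsPGroup.iff_card.1 P.isPGroup'
  refine ⟨k, ?_⟩
  rw [← hk, ← Subgroup.card_mul_index (P : Subgroup Gal(N/F)), hidx, mul_one]

include hℓ hF in
lemma exists_finrank_eq_pow (E : Type u) [Field E] [Algebra F E] [FiniteDimensional F E] :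
    ∃ k, Module.finrank F E = ℓ ^ k := by
  have := hF.perfectField hℓ
  let N := IntermediateField.normalClosure F E (AlgebraicClosure E)
  have hN : Normal F N := inferInstance
  have : IsGalois F N := {}
  obtain ⟨k, hk⟩ := hF.exists_card_aut_eq_pow hℓ N
  rw [IsGalois.card_aut_eq_finrank, ← Module.finrank_mul_finrank F E N] at hk
  obtain ⟨i, _, hi⟩ := (Nat.dvd_prime_pow hℓ).1 (Dvd.intro _ hk)
  exact ⟨i, hi⟩

-- A finite extension of `K` has `ℓ`-power degree over `F`, hence over `K`.
include hℓ hF in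
lemma of_finite (K : Type u) [Field K] [Algebra F K] [FiniteDimensional F K] :
    IsSpecialField ℓ K where
  ringChar_ne := by
    rw [← Algebra.ringChar_eq F K]
    exact hF.ringChar_ne
  finrank_eq_one E _ _ _ hc := by
    algebraize [(algebraMap K E).comp (algebraMap F K)]
    have : FiniteDimensional F E := FiniteDimensional.trans F K E
    obtain ⟨k, hk⟩ := hF.exists_finrank_eq_pow hℓ E
    rw [← Module.finrank_mul_finrank F K E] at hk
    obtain ⟨i, _, hi⟩ := (Nat.dvd_prime_pow hℓ).1 (Dvd.intro_left _ hk)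
    rw [hi] at hc ⊢
    rcases Nat.eq_zero_or_pos i with rfl | hpos
    · rw [pow_zero]
    · rw [Nat.coprime_pow_left_iff hpos, Nat.coprime_self] at hc
      exact absurd hc hℓ.one_lt.ne'

include hℓ hF in
lemma natCast_ne_zero : (ℓ : F) ≠ 0 := fun h => by
  have h2 := (ringChar.spec F ℓ).1 h
  rcases (Nat.dvd_prime hℓ).1 h2 with h3 | h3
  · have : (1 : F) = 0 := by simpa using (ringChar.spec F 1).2 (by rw [h3])
    exact one_ne_zero this
  · exact hF.ringChar_ne h3

-- The cyclotomic polynomial has degree `ℓ - 1 < ℓ`, so it splits.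
include hℓ hF in
lemma exists_isPrimitiveRoot : ∃ ζ : F, IsPrimitiveRoot ζ ℓ := by
  have : NeZero (ℓ : F) := ⟨hF.natCast_ne_zero hℓ⟩
  have hdeg : (cyclotomic ℓ F).natDegree = ℓ - 1 := by
    rw [natDegree_cyclotomic, Nat.totient_prime hℓ]
  have := hℓ.two_le
  have hs := hF.splits_of_natDegree_lt hℓ (q := cyclotomic ℓ F) (by lia)
  obtain ⟨ζ, hζ⟩ := hs.exists_eval_eq_zero (by
    rw [degree_eq_natDegree (cyclotomic_ne_zero ℓ F), hdeg]
    exact_mod_cast (by lia : ℓ - 1 ≠ 0))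
  exact ⟨ζ, isRoot_cyclotomic_iff.1 hζ⟩

section Degree

variable {L : Type u} [Field L] [Algebra F L] (hfin : Module.finrank F L = ℓ)

include hℓ hfin in
lemma finiteDimensional_of_finrank_eq : FiniteDimensional F L :=
  Module.finite_of_finrank_pos (hfin ▸ hℓ.pos)

-- Over `L`, which is special too, a minimal polynomial loses a linear factor; the quotient has
-- degree below `ℓ` and splits.
include hℓ hF hfin in
lemma isGalois_of_finrank_eq : IsGalois F L := by
  have := hF.perfectField hℓ
  have := finiteDimensional_of_finrank_eq hℓ hfin
  have hL := hF.of_finite hℓ L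
  have hN : Normal F L := by
    rw [normal_iff]
    refine fun x => ⟨Algebra.IsIntegral.isIntegral x, ?_⟩
    have hx : IsIntegral F x := Algebra.IsIntegral.isIntegral x
    have hroot : ((minpoly F x).map (algebraMap F L)).IsRoot x := by
      rw [IsRoot, eval_map_algebraMap, minpoly.aeval]
    have h := mul_divByMonic_eq_iff_isRoot.2 hroot
    rw [← h]
    refine (Splits.X_sub_C x).mul (hL.splits_of_natDegree_lt hℓ ?_)
    rw [natDegree_divByMonic _ (monic_X_sub_C x), natDegree_map, natDegree_X_sub_C]
    have h1 := minpoly.natDegree_le (A := F) x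
    have h2 := minpoly.natDegree_pos hx
    have := hℓ.pos
    lia
  exact {}

include hℓ hF hfin in
lemma isCyclic_of_finrank_eq : IsCyclic Gal(L/F) := by
  have := Fact.mk hℓ
  have := finiteDimensional_of_finrank_eq hℓ hfin
  have := hF.isGalois_of_finrank_eq hℓ hfin
  exact isCyclic_of_prime_card (p := ℓ) (by rw [IsGalois.card_aut_eq_finrank, hfin])

include hℓ hF hfin in
lemma exists_isKummerGenerator : ∃ a : Fˣ, IsKummerGenerator ℓ F L a := by
  have := finiteDimensional_of_finrank_eq hℓ hfin
  have := hF.isGalois_of_finrank_eq hℓ hfin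
  have := hF.isCyclic_of_finrank_eq hℓ hfin
  obtain ⟨ζ, hζ⟩ := hF.exists_isPrimitiveRoot hℓ
  obtain ⟨α, ⟨a, ha⟩, htop⟩ := exists_root_adjoin_eq_top_of_isCyclic F L
    ⟨ζ, by rwa [hfin, mem_primitiveRoots hℓ.pos]⟩
  rw [hfin] at ha
  have ha0 : a ≠ 0 := by
    rintro rfl
    rw [map_zero, eq_comm, pow_eq_zero_iff hℓ.ne_zero] at ha
    rw [ha, IntermediateField.adjoin_zero, IntermediateField.bot_eq_top_iff_finrank_eq_one,
      hfin] at htop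
    exact hℓ.one_lt.ne' htop
  exact ⟨Units.mk0 a ha0, α, ha.symm, htop⟩

include hℓ hF hfin in
lemma exists_powerBasis : ∃ pb : PowerBasis F L, pb.dim = ℓ := by
  have := finiteDimensional_of_finrank_eq hℓ hfin
  have := hF.isGalois_of_finrank_eq hℓ hfin
  let pb := Field.powerBasisOfFiniteOfSeparable F L
  exact ⟨pb, by rw [← pb.finrank, hfin]⟩

-- Rules out the default value `0` in the definition of `transfer`.
include hℓ hF hfin in
lemma isTransfer_transfer {m : ℕ} (hm : m ≠ 0) : IsTransfer ℓ m F L (transfer ℓ m F L) := by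
  obtain ⟨pb, hdim⟩ := hF.exists_powerBasis hℓ hfin
  have h := exists_isTransfer pb (fun q hq => hF.splits_of_natDegree_lt hℓ (hdim ▸ hq)) hℓ hdim hm
  rw [transfer, dif_pos h]
  exact h.choose_spec

include hℓ hF hfin in
lemma hom_ext_of_finrank_eq {m : ℕ} (hm : m ≠ 0) {A : Type*}
    [AddCommGroup A] {f g : MilnorKMod ℓ L m →ₗ[ℤ] A}
    (hfg : ∀ (a : Fin m → Fˣ) (j : Fin m) (b : Lˣ),
      f (symbol ℓ (Function.update (fun i => unitIncl F L (a i)) j b)) =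
        g (symbol ℓ (Function.update (fun i => unitIncl F L (a i)) j b))) : f = g := by
  obtain ⟨pb, hdim⟩ := hF.exists_powerBasis hℓ hfin
  have hdim1 : pb.dim ≠ 1 := hdim ▸ hℓ.one_lt.ne'
  exact hom_ext_of_splitUnits ℓ (algebraMap F L) pb.gen (gen_ne_algebraMap pb hdim1)
    (splitUnits_gen_eq_top pb hdim1 fun q hq => hF.splits_of_natDegree_lt hℓ (hdim ▸ hq)) hm hfg

end Degree

end IsSpecialField

end MilnorKMod

end

/-! ### Projection formula, base change and norms -/

noncomputable section

namespace MilnorKMod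

section Functoriality

variable {ℓ : ℕ} {K L : Type u} [Field K] [Field L] [Algebra K L]

lemma units_map_update {K L : Type*} [Field K] [Field L] (f : K →+* L) {m : ℕ} (a : Fin m → Kˣ)
    (j : Fin m) (b : Kˣ) :
    (fun i => Units.map (f : K →* L) (Function.update a j b i)) =
      Function.update (fun i => Units.map (f : K →* L) (a i)) j (Units.map (f : K →* L) b) := by
  ext i
  by_cases hi : i = j
  · subst hi; simp
  · simp [hi]

lemma IsTransfer.unitMul_incl {m : ℕ} {T : MilnorKMod ℓ L (m + 1) →ₗ[ℤ] MilnorKMod ℓ K (m + 1)}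
    (hT : IsTransfer ℓ (m + 1) K L T) (b : Lˣ) (y : MilnorKMod ℓ K m) :
    T (unitMul ℓ m b (incl ℓ m K L y)) = unitMul ℓ m (unitNorm K L b) y := by
  have : T ∘ₗ unitMul ℓ m b ∘ₗ incl ℓ m K L = unitMul ℓ m (unitNorm K L b) := by
    refine hom_ext fun a => ?_
    rw [LinearMap.comp_apply, LinearMap.comp_apply, incl, map_symbol, unitMul_symbol,
      unitMul_symbol]
    have h := hT.symbol_update (Fin.cons 1 a) 0 b
    rw [Fin.update_zero_eq_cons, Fin.update_zero_eq_cons] at h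
    exact h
  exact LinearMap.congr_fun this y

variable {K' L' : Type u} [Field K'] [Field L'] [Algebra K' L']

/-- On symbols with one nonconstant entry this is the compatibility of norms `hN`. It serves both
for base change and for semilinear automorphisms. -/
lemma transfer_map (hℓ : ℓ.Prime) (hK : IsSpecialField ℓ K) (hfin : Module.finrank K L = ℓ)
    (hK' : IsSpecialField ℓ K') (hfin' : Module.finrank K' L' = ℓ)
    {m : ℕ} (hm : m ≠ 0) (f : K →+* K') (g : L →+* L')
    (hfg : ∀ x, g (algebraMap K L x) = algebraMap K' L' (f x))
    (hN : ∀ b, Algebra.norm K' (g b) = f (Algebra.norm K b)) (y : MilnorKMod ℓ L m) :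
    transfer ℓ m K' L' (map ℓ m g y) = map ℓ m f (transfer ℓ m K L y) := by
  have hT := hK.isTransfer_transfer hℓ hfin hm
  have hT' := hK'.isTransfer_transfer hℓ hfin' hm
  have : transfer ℓ m K' L' ∘ₗ map ℓ m g = map ℓ m f ∘ₗ transfer ℓ m K L := by
    refine hK.hom_ext_of_finrank_eq hℓ hfin hm fun a j b => ?_
    rw [LinearMap.comp_apply, LinearMap.comp_apply, hT.symbol_update, map_symbol, map_symbol,
      units_map_update, units_map_update]
    have h1 : (fun i => Units.map (g : L →* L') (unitIncl K L (a i))) =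
        fun i => unitIncl K' L' (Units.map (f : K →* K') (a i)) :=
      funext fun i => Units.ext (hfg _)
    have h2 : Units.map (f : K →* K') (unitNorm K L b) =
        unitNorm K' L' (Units.map (g : L →* L') b) := Units.ext (hN _).symm
    rw [h1, h2, hT'.symbol_update]
  exact LinearMap.congr_fun this y

lemma symbol_update_prod {m : ℕ} (a : Fin m → Kˣ) (j : Fin m) {ι : Type*} (s : Finset ι)
    (b : ι → Kˣ) : symbol ℓ (Function.update a j (∏ i ∈ s, b i)) =
      ∑ i ∈ s, symbol ℓ (Function.update a j (b i)) := by
  have h (c : Kˣ) : symbol ℓ (Function.update a j c) = symbolMultilinear ℓ m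
      (Function.update (fun i => Additive.ofMul (a i)) j (Additive.ofMul c)) := by
    rw [symbol_eq]
    refine congrArg _ (funext fun i => ?_)
    by_cases hi : i = j
    · subst hi; simp
    · simp [hi]
  simp only [h, ofMul_prod, MultilinearMap.map_update_sum]

lemma unitMul_prod {m : ℕ} {ι : Type*} (s : Finset ι) (b : ι → Kˣ) (y : MilnorKMod ℓ K m) :
    unitMul ℓ m (∏ i ∈ s, b i) y = ∑ i ∈ s, unitMul ℓ m (b i) y := by
  classical
  induction s using Finset.induction with
  | empty =>
    have := unitMul_mul ℓ (n := m) (1 : Kˣ) 1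
    rw [mul_one, left_eq_add] at this
    rw [Finset.prod_empty, this, Finset.sum_empty, LinearMap.zero_apply]
  | insert i s hi ih =>
    rw [Finset.prod_insert hi, Finset.sum_insert hi, unitMul_mul, LinearMap.add_apply, ih]

lemma symbol_eq_zero_of_pow {m : ℕ} (a : Fin m → Kˣ) (j : Fin m) (b : K)
    (h : b ^ ℓ = a j) (hℓ : ℓ ≠ 0) : symbol ℓ a = 0 := by
  have hb : b ≠ 0 := by
    rintro rfl
    rw [zero_pow hℓ] at h
    exact (a j).ne_zero h.symm
  have h2 := symbol_update_prod (ℓ := ℓ) a j (Finset.range ℓ) fun _ => Units.mk0 b hb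
  rw [Finset.prod_const, Finset.sum_const, Finset.card_range,
    show Units.mk0 b hb ^ ℓ = a j from Units.ext (by simpa using h), Function.update_eq_self] at h2
  rw [h2, ← natCast_zsmul, smul_eq_zero]

/-- On generating symbols this is `N(b) = ∏ σ(b)`. -/
lemma incl_transfer (hℓ : ℓ.Prime) (hK : IsSpecialField ℓ K) (hfin : Module.finrank K L = ℓ)
    [FiniteDimensional K L] [IsGalois K L] {m : ℕ} (hm : m ≠ 0) (y : MilnorKMod ℓ L m) :
    incl ℓ m K L (transfer ℓ m K L y) = ∑ σ : Gal(L/K), galoisRep ℓ m K L σ y := by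
  have hT := hK.isTransfer_transfer hℓ hfin hm
  have : incl ℓ m K L ∘ₗ transfer ℓ m K L = ∑ σ : Gal(L/K), galoisRep ℓ m K L σ := by
    refine hK.hom_ext_of_finrank_eq hℓ hfin hm fun a j b => ?_
    have h1 : Units.map (algebraMap K L : K →* L) (unitNorm K L b) =
        ∏ σ : Gal(L/K), Units.map ((σ : L →+* L) : L →* L) b := by
      refine Units.ext ?_
      simpa using Algebra.norm_eq_prod_automorphisms K (b : L)
    rw [LinearMap.comp_apply, hT.symbol_update, incl, map_symbol, units_map_update, h1,
      symbol_update_prod, LinearMap.sum_apply]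
    refine Finset.sum_congr rfl fun σ _ => ?_
    change _ = map ℓ m (σ : L →+* L) _
    rw [map_symbol, units_map_update]
    congr 2
    exact funext fun i => Units.ext (by simp)
  rw [← LinearMap.comp_apply, this, LinearMap.sum_apply]

lemma unitMul_galoisRep {m : ℕ} (σ : Gal(L/K)) (b : Lˣ) (y : MilnorKMod ℓ L m) :
    galoisRep ℓ (m + 1) K L σ (unitMul ℓ m b y) =
      unitMul ℓ m (Units.map ((σ : L →+* L) : L →* L) b) (galoisRep ℓ m K L σ y) :=
  map_unitMul ℓ _ b y

lemma unitMul_unitIncl_galoisRep {m : ℕ} (σ : Gal(L/K)) (c : Kˣ) (y : MilnorKMod ℓ L m) :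
    galoisRep ℓ (m + 1) K L σ (unitMul ℓ m (unitIncl K L c) y) =
      unitMul ℓ m (unitIncl K L c) (galoisRep ℓ m K L σ y) := by
  rw [unitMul_galoisRep]
  congr 2
  exact Units.ext (by simp)

variable (ℓ K L) in
/-- Multiplication by the class of an element of the base field on coinvariants. -/
def coinvMul (m : ℕ) (c : Kˣ) : GaloisCoinvariants ℓ m K L →ₗ[ℤ] GaloisCoinvariants ℓ (m + 1) K L :=
  Representation.Coinvariants.lift (galoisRep ℓ m K L)
    (Representation.Coinvariants.mk _ ∘ₗ unitMul ℓ m (unitIncl K L c)) fun σ => by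
      refine LinearMap.ext fun y => ?_
      exact (congrArg (Representation.Coinvariants.mk _)
        (unitMul_unitIncl_galoisRep σ c y).symm).trans
        (Representation.Coinvariants.mk_self_apply _ σ _)

lemma coinvMul_mk {m : ℕ} (c : Kˣ) (y : MilnorKMod ℓ L m) :
    coinvMul ℓ K L m c (Representation.Coinvariants.mk _ y) =
      Representation.Coinvariants.mk _ (unitMul ℓ m (unitIncl K L c) y) := rfl

lemma transferCoinv_mk {m : ℕ} (y : MilnorKMod ℓ L m) :
    transferCoinv ℓ m K L (Representation.Coinvariants.mk _ y) = transfer ℓ m K L y := rfl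

end Functoriality

section Norm

open IntermediateField

variable {K A B C : Type*} [Field K] [Field A] [Field B] [Field C] [Algebra K A] [Algebra K B]
  [Algebra K C] [Algebra A C] [Algebra B C] [IsScalarTower K A C] [IsScalarTower K B C]

/-- The norm is compatible with base change. -/
lemma norm_algebraMap_of_sup_eq_top [FiniteDimensional K C]
    (hfin : Module.finrank K C = Module.finrank K A * Module.finrank K B)
    (hsup : (IsScalarTower.toAlgHom K A C).fieldRange ⊔ (IsScalarTower.toAlgHom K B C).fieldRange =
      ⊤) (x : B) :
    Algebra.norm A (algebraMap B C x) = algebraMap K A (Algebra.norm K x) := by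
  let eA : A ≃ₐ[K] (IsScalarTower.toAlgHom K A C).fieldRange :=
    AlgEquiv.ofInjectiveField (IsScalarTower.toAlgHom K A C)
  let eB : B ≃ₐ[K] (IsScalarTower.toAlgHom K B C).fieldRange :=
    AlgEquiv.ofInjectiveField (IsScalarTower.toAlgHom K B C)
  -- The degree of the compositum is the product of the degrees, which forces linear disjointness.
  have hdisj : (IsScalarTower.toAlgHom K A C).fieldRange.LinearDisjoint
      (IsScalarTower.toAlgHom K B C).fieldRange := by
    refine LinearDisjoint.of_finrank_sup ?_
    rw [hsup, finrank_top', hfin, eA.toLinearEquiv.finrank_eq, eB.toLinearEquiv.finrank_eq]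
  have h := hdisj.norm_algebraMap hsup (eB x)
  have h2 := Algebra.norm_eq_of_equiv_equiv eA.toRingEquiv (RingEquiv.refl C)
    (by ext; rfl) (algebraMap B C x)
  rw [h2]
  change eA.symm (Algebra.norm _ (algebraMap _ C (eB x))) = _
  rw [h, Algebra.norm_eq_of_algEquiv, AlgEquiv.commutes]

end Norm

-- The norm is the value at `1` of the minimal polynomial `X ^ ℓ - a`.
open Polynomial IntermediateField in
lemma norm_one_sub_of_irreducible {ℓ : ℕ} {K L : Type u} [Field K] [Field L] [Algebra K L]
    [FiniteDimensional K L] (hfin : Module.finrank K L = ℓ) {a : K}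
    (hirr : Irreducible (X ^ ℓ - C a)) {α : L} (hα : α ^ ℓ = algebraMap K L a) :
    K⟮α⟯ = ⊤ ∧ Algebra.norm K (1 - α) = 1 - a := by
  have hℓ : ℓ ≠ 0 := hfin ▸ Module.finrank_pos.ne'
  have hmin : minpoly K α = X ^ ℓ - C a :=
    (minpoly.eq_of_irreducible_of_monic hirr (by simp [hα]) (monic_X_pow_sub_C a hℓ)).symm
  have hint : IsIntegral K α := Algebra.IsIntegral.isIntegral α
  have htop : K⟮α⟯ = ⊤ := by
    rw [Field.primitive_element_iff_minpoly_natDegree_eq, hmin, hfin, natDegree_X_pow_sub_C]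
  refine ⟨htop, ?_⟩
  have hadj : Algebra.adjoin K {α} = ⊤ := by
    rw [← IntermediateField.adjoin_simple_toSubalgebra_of_isAlgebraic hint.isAlgebraic, htop,
      top_toSubalgebra]
  let pb := PowerBasis.ofAdjoinEqTop' hint hadj
  have h := norm_algebraMap_sub_gen pb 1
  have hgen : pb.gen = α := PowerBasis.ofAdjoinEqTop'_gen hint hadj
  rw [hgen, hmin, map_one] at h
  simpa using h

end MilnorKMod

end

/-! ### The Steinberg relation in the coinvariants -/

noncomputable section

namespace MilnorKMod

section Tower

open IntermediateField

variable {ℓ : ℕ} (hℓ : ℓ.Prime) {K L : Type u} [Field K] [Field L] [Algebra K L]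
  (hK : IsSpecialField ℓ K) (hKL : Module.finrank K L = ℓ)

-- The map `Φ(w) = [tr_{L'/L}({1 - α} w)]` kills differences `τ w - w` and everything coming from
-- `k_n(K')`. The image of `y` in `k_n(L')` has transfer `{v}` over `K'`, which vanishes since `a`
-- becomes an `ℓ`-th power; so by exactness for `L'/K'` its class comes from `k_n(K')`, and `Φ`
-- kills it. By the projection formula its value under `Φ` is `[{c} y]`.
include hℓ hK hKL in
lemma mk_unitMul_eq_zero_of_tower {n : ℕ} (hn : n ≠ 0)
    (h0 : Subsingleton (MilnorKMod ℓ K (n + 1)))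
    {K' L' : Type u} [Field K'] [Field L'] [Algebra K K'] [Algebra K' L'] [Algebra L L']
    [Algebra K L'] [IsScalarTower K K' L'] [IsScalarTower K L L']
    (hKK' : Module.finrank K K' = ℓ) (hKL' : Module.finrank K' L' = ℓ)
    (hLL' : Module.finrank L L' = ℓ)
    (hsup : (IsScalarTower.toAlgHom K K' L').fieldRange ⊔
      (IsScalarTower.toAlgHom K L L').fieldRange = ⊤)
    (hex : FourTermExact ℓ n K' L')
    {a c : Kˣ} (hac : (a : K) + c = 1) {α : K'} (hα : α ^ ℓ = algebraMap K K' a)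
    (hnorm : Algebra.norm L (1 - algebraMap K' L' α) = 1 - algebraMap K L a)
    (y : MilnorKMod ℓ L n) (v : Fin n → Kˣ) (i : Fin n) (hv : v i = a)
    (hy : transfer ℓ n K L y = symbol ℓ v) :
    Representation.Coinvariants.mk (galoisRep ℓ (n + 1) K L)
      (unitMul ℓ n (unitIncl K L c) y) = 0 := by
  have := IsSpecialField.finiteDimensional_of_finrank_eq hℓ hKL
  have := IsSpecialField.finiteDimensional_of_finrank_eq hℓ hKK'
  have := IsSpecialField.finiteDimensional_of_finrank_eq hℓ hKL'
  have := IsSpecialField.finiteDimensional_of_finrank_eq hℓ hLL'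
  have : FiniteDimensional K L' := FiniteDimensional.trans K L L'
  have hL := hK.of_finite hℓ L
  have hK' := hK.of_finite hℓ K'
  have := hK.isGalois_of_finrank_eq hℓ hKL
  have hfin : Module.finrank K L' = ℓ * ℓ := by
    rw [← Module.finrank_mul_finrank K L L', hKL, hLL']
  have hcomm (x : K) : algebraMap L L' (algebraMap K L x) =
      algebraMap K' L' (algebraMap K K' x) := by
    rw [← IsScalarTower.algebraMap_apply, ← IsScalarTower.algebraMap_apply]
  have hα1 : (1 - α : K') ≠ 0 := by
    intro h
    rw [← eq_of_sub_eq_zero h, one_pow, ← map_one (algebraMap K K')] at hα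
    have := (algebraMap K K').injective hα
    rw [← this, add_eq_left] at hac
    exact c.ne_zero hac
  let β : K'ˣ := Units.mk0 (1 - α) hα1
  have hβ : unitNorm L L' (unitIncl K' L' β) = unitIncl K L c := by
    refine Units.ext ?_
    change Algebra.norm L (algebraMap K' L' (1 - α)) = algebraMap K L c
    rw [map_sub, map_one, hnorm, ← map_one (algebraMap K L), ← map_sub, ← hac, add_sub_cancel_left]
  have hres (τ : Gal(L'/K')) : ∃ σ : Gal(L/K), ∀ x, τ (algebraMap L L' x) = algebraMap L L' (σ x) :=
    ⟨(τ.restrictScalars K).restrictNormal L, fun x =>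
      ((τ.restrictScalars K).restrictNormal_commutes L x).symm⟩
  let Φ : MilnorKMod ℓ L' n →+ GaloisCoinvariants ℓ (n + 1) K L :=
    (Representation.Coinvariants.mk (galoisRep ℓ (n + 1) K L)).toAddMonoidHom.comp
      (transfer ℓ (n + 1) L L' ∘ₗ unitMul ℓ n (unitIncl K' L' β)).toAddMonoidHom
  have hΦ (τ : Gal(L'/K')) (w : MilnorKMod ℓ L' n) : Φ (galoisRep ℓ n K' L' τ w) = Φ w := by
    -- As `1 - α` lies in `K'`, it is fixed by `τ`; the transfer to `L` turns `τ` into its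
    -- restriction `σ`, invisible in the coinvariants.
    obtain ⟨σ, hσ⟩ := hres τ
    have h1 := transfer_map hℓ hL hLL' hL hLL' (Nat.succ_ne_zero n) (σ : L →+* L) (τ : L' →+* L')
      (fun x => hσ x) (fun b => by
        have := Algebra.norm_eq_of_equiv_equiv (σ : L ≃+* L) (τ : L' ≃+* L')
          (by ext x; exact (hσ x).symm) b
        rw [this]
        exact ((σ : L ≃+* L).apply_symm_apply _).symm)
      (unitMul ℓ n (unitIncl K' L' β) w)
    change Representation.Coinvariants.mk (galoisRep ℓ (n + 1) K L)
      (transfer ℓ (n + 1) L L' (unitMul ℓ n (unitIncl K' L' β) (galoisRep ℓ n K' L' τ w))) = _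
    rw [← unitMul_unitIncl_galoisRep]
    change Representation.Coinvariants.mk (galoisRep ℓ (n + 1) K L)
      (transfer ℓ (n + 1) L L' (map ℓ (n + 1) (τ : L' →+* L') _)) = _
    rw [h1]
    exact Representation.Coinvariants.mk_self_apply _ σ _
  have hker (w : MilnorKMod ℓ L' n)
      (hw : w ∈ Representation.Coinvariants.ker (galoisRep ℓ n K' L')) : Φ w = 0 := by
    induction hw using Submodule.span_induction with
    | mem w hw =>
      obtain ⟨⟨τ, w⟩, rfl⟩ := hw
      rw [map_sub, sub_eq_zero]
      exact hΦ τ w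
    | zero => exact map_zero _
    | add x y _ _ hx hy => rw [map_add, hx, hy, add_zero]
    | smul k x _ hx => rw [map_zsmul, hx, smul_zero]
  -- By base change the transfer comes from `tr_{K'/K}({1 - α} z)` in `k_{n+1}(K) = 0`.
  have hΦincl (z : MilnorKMod ℓ K' n) : Φ (incl ℓ n K' L' z) = 0 := by
    have h1 := transfer_map hℓ hK hKK' hL hLL' (Nat.succ_ne_zero n) (algebraMap K L)
      (algebraMap K' L') (fun x => (hcomm x).symm)
      (norm_algebraMap_of_sup_eq_top (by rw [hfin, hKL, hKK']) (by rw [sup_comm, hsup]))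
      (unitMul ℓ n β z)
    rw [Subsingleton.elim (transfer ℓ (n + 1) K K' _) 0, map_zero, map_unitMul] at h1
    change Representation.Coinvariants.mk (galoisRep ℓ (n + 1) K L)
      (transfer ℓ (n + 1) L L' (unitMul ℓ n (unitIncl K' L' β) (map ℓ n (algebraMap K' L') z))) = 0
    rw [h1]
    exact map_zero _
  have hΦy : Φ (map ℓ n (algebraMap L L') y) =
      Representation.Coinvariants.mk (galoisRep ℓ (n + 1) K L)
        (unitMul ℓ n (unitIncl K L c) y) := by
    have h1 := (hL.isTransfer_transfer hℓ hLL' (Nat.succ_ne_zero n)).unitMul_incl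
      (unitIncl K' L' β) y
    rw [hβ] at h1
    exact congrArg _ h1
  have htr : transfer ℓ n K' L' (map ℓ n (algebraMap L L') y) = 0 := by
    rw [transfer_map hℓ hK hKL hK' hKL' hn (algebraMap K K') (algebraMap L L') hcomm
      (norm_algebraMap_of_sup_eq_top (by rw [hfin, hKL, hKK']) hsup), hy, map_symbol]
    exact symbol_eq_zero_of_pow _ i α (by rw [hα, hv]; rfl) hℓ.ne_zero
  obtain ⟨z, hz⟩ := (hex.exact_coinvariants (Representation.Coinvariants.mk _
    (map ℓ n (algebraMap L L') y))).1 htr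
  have hz' := hker _ ((Representation.Coinvariants.mk_eq_iff _).1 hz)
  rw [map_sub, hΦincl, zero_sub, neg_eq_zero] at hz'
  rw [← hΦy, hz']

-- With `β = 1 - α` of norm `c`, one has `[{c} y] = ∑ [{σβ} y] = ∑ [{β} σ⁻¹y] = [{β} i(tr y)]`, and
-- `i(tr y)` is a symbol with the entry `α ^ ℓ`.
include hℓ hK hKL in
lemma mk_unitMul_eq_zero_of_mem {n : ℕ} (hn : n ≠ 0)
    {a c : Kˣ} (hac : (a : K) + c = 1) {α : L} (hα : α ^ ℓ = algebraMap K L a)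
    (hnorm : Algebra.norm K (1 - α) = 1 - a)
    (y : MilnorKMod ℓ L n) (v : Fin n → Kˣ) (i : Fin n) (hv : v i = a)
    (hy : transfer ℓ n K L y = symbol ℓ v) :
    Representation.Coinvariants.mk (galoisRep ℓ (n + 1) K L)
      (unitMul ℓ n (unitIncl K L c) y) = 0 := by
  have := IsSpecialField.finiteDimensional_of_finrank_eq hℓ hKL
  have := hK.isGalois_of_finrank_eq hℓ hKL
  have hc : Algebra.norm K (1 - α) = c := by rw [hnorm, ← hac, add_sub_cancel_left]
  have hα1 : (1 - α : L) ≠ 0 := by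
    intro h
    rw [h, Algebra.norm_zero] at hc
    exact c.ne_zero hc.symm
  let β : Lˣ := Units.mk0 (1 - α) hα1
  have hβ : unitIncl K L c = ∏ σ : Gal(L/K), Units.map ((σ : L →+* L) : L →* L) β := by
    refine Units.ext ?_
    have := Algebra.norm_eq_prod_automorphisms K (1 - α)
    rw [hc] at this
    rw [Units.coe_prod]
    exact this
  have h1 (σ : Gal(L/K)) : Representation.Coinvariants.mk (galoisRep ℓ (n + 1) K L)
      (unitMul ℓ n (Units.map ((σ : L →+* L) : L →* L) β) y) =
      Representation.Coinvariants.mk (galoisRep ℓ (n + 1) K L)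
        (unitMul ℓ n β (galoisRep ℓ n K L σ⁻¹ y)) := by
    have h := Representation.Coinvariants.mk_self_apply (galoisRep ℓ (n + 1) K L) σ
      (unitMul ℓ n β (galoisRep ℓ n K L σ⁻¹ y))
    rw [unitMul_galoisRep, Representation.self_inv_apply] at h
    exact h
  have h2 := incl_transfer hℓ hK hKL hn y
  rw [hy, incl, map_symbol, symbol_eq_zero_of_pow _ i α (by rw [hα, hv]; rfl) hℓ.ne_zero] at h2
  rw [hβ, unitMul_prod, map_sum, Finset.sum_congr rfl fun σ _ => h1 σ, ← map_sum, ← map_sum,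
    Fintype.sum_equiv (Equiv.inv Gal(L/K)) (fun σ => galoisRep ℓ n K L σ⁻¹ y)
      (fun σ => galoisRep ℓ n K L σ y) fun σ => rfl, ← h2,
    map_zero, map_zero]

-- Each `x` is some `tr y`, and `i(tr y) = ∑ σ y` has class `ℓ [y] = 0`.
include hℓ hK hKL in
lemma inclCoinv_eq_zero {n : ℕ} (hn : n ≠ 0)
    (hsurj : Function.Surjective (transferCoinv ℓ n K L)) (x : MilnorKMod ℓ K n) :
    inclCoinv ℓ n K L x = 0 := by
  have := IsSpecialField.finiteDimensional_of_finrank_eq hℓ hKL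
  have := hK.isGalois_of_finrank_eq hℓ hKL
  obtain ⟨z, rfl⟩ := hsurj x
  obtain ⟨y, rfl⟩ := Representation.Coinvariants.mk_surjective _ z
  change Representation.Coinvariants.mk (galoisRep ℓ n K L)
    (incl ℓ n K L (transfer ℓ n K L y)) = 0
  rw [incl_transfer hℓ hK hKL hn, map_sum, Finset.sum_congr rfl fun σ _ =>
    Representation.Coinvariants.mk_self_apply (galoisRep ℓ n K L) σ y, Finset.sum_const,
    ← map_nsmul, Finset.card_univ, ← Nat.card_eq_fintype_card, IsGalois.card_aut_eq_finrank, hKL,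
    ← natCast_zsmul, smul_eq_zero, map_zero]

end Tower

end MilnorKMod

end

/-! ### Lifting multiplication by constants to `k_{n+1}(K)` -/

noncomputable section

namespace MilnorKMod

section Step

open IntermediateField Polynomial

variable {ℓ : ℕ} (hℓ : ℓ.Prime) {K L : Type u} [Field K] [Field L] [Algebra K L]
  (hK : IsSpecialField ℓ K) (hKL : Module.finrank K L = ℓ)

-- Here `X ^ ℓ - a` stays irreducible over `L`, so adjoining a root `ρ` to `L` gives the square of
-- fields `K`, `K(ρ)`, `L`, `L(ρ)` with all steps of degree `ℓ`.
include hℓ hK hKL in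
lemma mk_unitMul_eq_zero_of_forall_ne {n : ℕ} (hn : n ≠ 0)
    (h0 : Subsingleton (MilnorKMod ℓ K (n + 1)))
    (hex : ∀ (K' L' : Type u) [Field K'] [Field L'] [Algebra K K'] [Algebra K' L'],
      FiniteDimensional K K' → Module.finrank K' L' = ℓ → FourTermExact ℓ n K' L')
    {a c : Kˣ} (hac : (a : K) + c = 1) (ha : ∀ β : L, β ^ ℓ ≠ algebraMap K L a)
    (y : MilnorKMod ℓ L n) (v : Fin n → Kˣ) (i : Fin n) (hv : v i = a)
    (hy : transfer ℓ n K L y = symbol ℓ v) :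
    Representation.Coinvariants.mk (galoisRep ℓ (n + 1) K L)
      (unitMul ℓ n (unitIncl K L c) y) = 0 := by
  have := IsSpecialField.finiteDimensional_of_finrank_eq hℓ hKL
  have hirrL : Irreducible (X ^ ℓ - C (algebraMap K L a)) :=
    X_pow_sub_C_irreducible_of_prime hℓ ha
  have hirrK : Irreducible (X ^ ℓ - C (a : K)) :=
    X_pow_sub_C_irreducible_of_prime hℓ fun β hβ => ha (algebraMap K L β) (by rw [← hβ, map_pow])
  have := Fact.mk hirrL
  let L' := AdjoinRoot (X ^ ℓ - C (algebraMap K L a))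
  let ρ : L' := AdjoinRoot.root _
  have hLL' : Module.finrank L L' = ℓ := by
    rw [(AdjoinRoot.powerBasis hirrL.ne_zero).finrank, AdjoinRoot.powerBasis_dim,
      natDegree_X_pow_sub_C]
  have := IsSpecialField.finiteDimensional_of_finrank_eq hℓ hLL'
  have : FiniteDimensional K L' := FiniteDimensional.trans K L L'
  have hρL : ρ ^ ℓ = algebraMap L L' (algebraMap K L a) := by
    have h := AdjoinRoot.eval₂_root (X ^ ℓ - C (algebraMap K L a))
    rw [eval₂_sub, eval₂_pow, eval₂_X, eval₂_C, sub_eq_zero] at h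
    exact h
  have hρ : ρ ^ ℓ = algebraMap K L' a := by rw [hρL, ← IsScalarTower.algebraMap_apply]
  have hmin : minpoly K ρ = X ^ ℓ - C (a : K) :=
    (minpoly.eq_of_irreducible_of_monic hirrK (by simp [hρ])
      (monic_X_pow_sub_C _ hℓ.ne_zero)).symm
  have hKK' : Module.finrank K K⟮ρ⟯ = ℓ := by
    rw [adjoin.finrank (Algebra.IsIntegral.isIntegral ρ), hmin, natDegree_X_pow_sub_C]
  have hKL' : Module.finrank K⟮ρ⟯ L' = ℓ := by
    have h := Module.finrank_mul_finrank K K⟮ρ⟯ L'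
    rw [← Module.finrank_mul_finrank K L L', hKL, hLL', hKK'] at h
    exact Nat.eq_of_mul_eq_mul_left hℓ.pos h
  obtain ⟨htop, hnorm⟩ := norm_one_sub_of_irreducible hLL' hirrL hρL
  have hsup : (IsScalarTower.toAlgHom K K⟮ρ⟯ L').fieldRange ⊔
      (IsScalarTower.toAlgHom K L L').fieldRange = ⊤ := by
    refine eq_top_iff.2 fun x _ => ?_
    have hx : x ∈ L⟮ρ⟯ := htop ▸ mem_top
    induction hx using adjoin_induction with
    | mem x hx =>
      rw [Set.mem_singleton_iff] at hx
      rw [hx]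
      exact (le_sup_left : _ ≤ (IsScalarTower.toAlgHom K K⟮ρ⟯ L').fieldRange ⊔ _)
        ⟨AdjoinSimple.gen K ρ, rfl⟩
    | algebraMap x =>
      exact (le_sup_right : (IsScalarTower.toAlgHom K L L').fieldRange ≤ _) ⟨x, rfl⟩
    | add x y _ _ hx hy => exact add_mem (hx mem_top) (hy mem_top)
    | inv x _ hx => exact inv_mem (hx mem_top)
    | mul x y _ _ hx hy => exact mul_mem (hx mem_top) (hy mem_top)
  exact mk_unitMul_eq_zero_of_tower hℓ hK hKL hn h0 hKK' hKL' hLL' hsup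
    (hex K⟮ρ⟯ L' inferInstance hKL') hac (α := AdjoinSimple.gen K ρ)
    (by
      apply Subtype.ext
      exact hρ)
    hnorm y v i hv hy

include hℓ hK hKL in
lemma mk_unitMul_eq_zero_of_steinberg {n : ℕ} (hn : n ≠ 0)
    (h0 : Subsingleton (MilnorKMod ℓ K (n + 1)))
    (hex : ∀ (K' L' : Type u) [Field K'] [Field L'] [Algebra K K'] [Algebra K' L'],
      FiniteDimensional K K' → Module.finrank K' L' = ℓ → FourTermExact ℓ n K' L')
    (hinj : Function.Injective (transferCoinv ℓ n K L))
    {a c : Kˣ} (hac : (a : K) + c = 1)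
    (y : MilnorKMod ℓ L n) (v : Fin n → Kˣ) (i : Fin n) (hv : v i = a)
    (hy : transfer ℓ n K L y = symbol ℓ v) :
    Representation.Coinvariants.mk (galoisRep ℓ (n + 1) K L)
      (unitMul ℓ n (unitIncl K L c) y) = 0 := by
  have := IsSpecialField.finiteDimensional_of_finrank_eq hℓ hKL
  by_cases hb : ∃ β : K, β ^ ℓ = a
  · obtain ⟨β, hβ⟩ := hb
    rw [symbol_eq_zero_of_pow v i β (by rw [hβ, hv]) hℓ.ne_zero] at hy
    have hy0 : Representation.Coinvariants.mk (galoisRep ℓ n K L) y = 0 :=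
      hinj ((transferCoinv_mk y).trans (hy.trans (map_zero _).symm))
    rw [← coinvMul_mk, hy0]
    exact map_zero _
  push Not at hb
  by_cases hα : ∃ α : L, α ^ ℓ = algebraMap K L a
  · obtain ⟨α, hα⟩ := hα
    exact mk_unitMul_eq_zero_of_mem hℓ hK hKL hn hac hα (norm_one_sub_of_irreducible hKL
      (X_pow_sub_C_irreducible_of_prime hℓ hb) hα).2 y v i hv hy
  · push Not at hα
    exact mk_unitMul_eq_zero_of_forall_ne hℓ hK hKL hn h0 hex hac hα y v i hv hy

include hℓ hK hKL in
lemma transferCoinv_bijective {n : ℕ} (hn : n ≠ 0)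
    (h0 : Subsingleton (MilnorKMod ℓ K (n + 1))) (hex : FourTermExact ℓ n K L) :
    Function.Bijective (transferCoinv ℓ n K L) := by
  obtain ⟨u, hu⟩ := hK.exists_isKummerGenerator hℓ hKL
  have hsurj : Function.Surjective (transferCoinv ℓ n K L) := fun x =>
    (hex.exact_base u hu x).1 (Subsingleton.elim _ _)
  refine ⟨(injective_iff_map_eq_zero _).2 fun z hz => ?_, hsurj⟩
  obtain ⟨x, rfl⟩ := (hex.exact_coinvariants z).1 hz
  exact inclCoinv_eq_zero hℓ hK hKL hn hsurj x

include hℓ hK hKL in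
lemma mk_unitMul_unitIncl_eq_zero {n : ℕ} (hn : n ≠ 0)
    (h0 : Subsingleton (MilnorKMod ℓ K (n + 1)))
    (hex : ∀ (K' L' : Type u) [Field K'] [Field L'] [Algebra K K'] [Algebra K' L'],
      FiniteDimensional K K' → Module.finrank K' L' = ℓ → FourTermExact ℓ n K' L')
    (c : Kˣ) (y : MilnorKMod ℓ L n) :
    Representation.Coinvariants.mk (galoisRep ℓ (n + 1) K L)
      (unitMul ℓ n (unitIncl K L c) y) = 0 := by
  have hbij := transferCoinv_bijective hℓ hK hKL hn h0 (hex K L inferInstance hKL)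
  let e : GaloisCoinvariants ℓ n K L ≃+ MilnorKMod ℓ K n :=
    AddEquiv.ofBijective (transferCoinv ℓ n K L).toAddMonoidHom hbij
  -- Multiplication by `c` on coinvariants, transported along the inverse of the transfer
  -- isomorphism.
  let μ (c : Kˣ) : MilnorKMod ℓ K n →ₗ[ℤ] GaloisCoinvariants ℓ (n + 1) K L :=
    ((coinvMul ℓ K L n c).toAddMonoidHom.comp e.symm.toAddMonoidHom).toIntLinearMap
  have hμ (c : Kˣ) (y : MilnorKMod ℓ L n) : μ c (transfer ℓ n K L y) =
      Representation.Coinvariants.mk (galoisRep ℓ (n + 1) K L)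
        (unitMul ℓ n (unitIncl K L c) y) := by
    change coinvMul ℓ K L n c (e.symm (e (Representation.Coinvariants.mk _ y))) = _
    rw [e.symm_apply_apply]
    rfl
  have hsurj (x : MilnorKMod ℓ K n) : ∃ y, transfer ℓ n K L y = x := by
    obtain ⟨z, rfl⟩ := hbij.2 x
    obtain ⟨y, rfl⟩ := Representation.Coinvariants.mk_surjective _ z
    exact ⟨y, rfl⟩
  have hmul (c d : Kˣ) : μ (c * d) = μ c + μ d := by
    refine LinearMap.ext fun x => ?_
    obtain ⟨y, rfl⟩ := hsurj x
    rw [LinearMap.add_apply, hμ, hμ, hμ, map_mul, unitMul_mul]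
    exact map_add _ _ _
  let f : MultilinearMap ℤ (fun _ : Fin (n + 1) => Additive Kˣ)
      (GaloisCoinvariants ℓ (n + 1) K L) :=
    LinearMap.uncurryLeft (AddMonoidHom.toIntLinearMap
      { toFun := fun c => (μ c.toMul).compMultilinearMap (symbolMultilinear ℓ n)
        map_zero' := by
          have h := hmul 1 1
          rw [mul_one, left_eq_add] at h
          change (μ 1).compMultilinearMap _ = 0
          rw [h]
          rfl
        map_add' := fun c d => by
          change (μ (c.toMul * d.toMul)).compMultilinearMap _ = _
          rw [hmul]
          rfl })
  have hf (a : Fin (n + 1) → Kˣ) :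
      f (fun k => Additive.ofMul (a k)) = μ (a 0) (symbol ℓ fun k => a k.succ) := rfl
  let φ : MilnorKMod ℓ K (n + 1) →ₗ[ℤ] GaloisCoinvariants ℓ (n + 1) K L :=
    lift ℓ f (fun a i j hij h => by
      rw [hf]
      -- A relation between the entries `0` and `1` is the essential case; later positions already
      -- vanish in `k_n(K)`.
      induction j using Fin.cases with
      | zero => simp at hij
      | succ j =>
        induction i using Fin.cases with
        | zero =>
          obtain ⟨y, hy⟩ := hsurj (symbol ℓ fun k => a k.succ)
          rw [← hy, hμ]
          exact mk_unitMul_eq_zero_of_steinberg hℓ hK hKL hn h0 hex hbij.1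
            (by rw [add_comm]; exact h) y _ j rfl hy
        | succ i =>
          rw [symbol_eq_zero ℓ _ i j (by simpa using hij) h, map_zero])
      (fun a => by
        change (ℓ : ℤ) • f (fun k => Additive.ofMul (a k).toMul) = 0
        rw [hf, ← map_zsmul, smul_eq_zero, map_zero])
  have hφ : μ c = φ ∘ₗ unitMul ℓ n c := by
    refine hom_ext fun a => ?_
    rw [LinearMap.comp_apply, unitMul_symbol, lift_symbol, hf]
    rfl
  -- The class factors through `k_{n+1}(K) = 0`.
  rw [← hμ, hφ, LinearMap.comp_apply, Subsingleton.elim (unitMul ℓ n c _) 0, map_zero]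

end Step

end MilnorKMod

end

/-! ### Vanishing in degree `ℓ` and induction along towers -/

noncomputable section

namespace MilnorKMod

lemma unitMul_anticomm (ℓ : ℕ) {F : Type u} [Field F] {n : ℕ} (a b : Fˣ) (x : MilnorKMod ℓ F n) :
    unitMul ℓ (n + 1) a (unitMul ℓ n b x) = -unitMul ℓ (n + 1) b (unitMul ℓ n a x) := by
  have h := LinearMap.congr_fun ((Total.mulLeft ℓ).anticomm a b)
    (DirectSum.lof ℤ ℕ (fun n => MilnorKMod ℓ F n) n x)
  rw [LinearMap.neg_apply, Module.End.mul_apply, Module.End.mul_apply, Total.mulLeft_lof,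
    Total.mulLeft_lof, Total.mulLeft_lof, Total.mulLeft_lof, ← map_neg] at h
  exact DirectSum.of_injective (β := fun n => MilnorKMod ℓ F n) (n + 1 + 1) h

/-- A cyclic group of prime order `ℓ` acting on a group of exponent `ℓ` without nontrivial
coinvariants acts on the trivial group. -/
lemma _root_.Representation.subsingleton_of_coinvariants {G M : Type*} [Group G]
    [AddCommGroup M] {ℓ : ℕ} (hℓ : ℓ.Prime) (hM : ∀ x : M, (ℓ : ℤ) • x = 0)
    (hG : Nat.card G = ℓ) (ρ : Representation ℤ G M)
    (h : ∀ x, Representation.Coinvariants.mk ρ x = 0) : Subsingleton M := by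
  have := Fact.mk hℓ
  have : Finite G := Nat.finite_of_card_ne_zero (hG ▸ hℓ.ne_zero)
  have := isCyclic_of_prime_card hG
  obtain ⟨σ, hσ⟩ := IsCyclic.exists_monoid_generator (α := G)
  let D : Module.End ℤ M := ρ σ - 1
  -- Since `σ` generates, `σ^k - 1` is `σ - 1` times a geometric sum; vanishing coinvariants thus
  -- make `D` surjective.
  have hker : Representation.Coinvariants.ker ρ ≤ LinearMap.range D := by
    refine Submodule.span_le.2 ?_
    rintro _ ⟨⟨τ, x⟩, rfl⟩
    obtain ⟨k, rfl⟩ := hσ τ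
    refine ⟨(∑ i ∈ Finset.range k, ρ σ ^ i) x, ?_⟩
    rw [← Module.End.mul_apply, mul_geom_sum, ← map_pow]
    rfl
  have hsurj : Function.Surjective D := fun x =>
    hker ((Representation.Coinvariants.mk_eq_zero ρ).1 (h x))
  -- Modulo `ℓ`, `(D + 1)^ℓ = D^ℓ + 1`, while `σ^ℓ = 1`. So `D` is both surjective and nilpotent.
  have hD : D ^ ℓ = 0 := by
    obtain ⟨r, hr⟩ := (Commute.one_right D).exists_add_pow_prime_eq hℓ
    have hℓ0 (T : Module.End ℤ M) : (ℓ : Module.End ℤ M) * T = 0 := LinearMap.ext fun x => by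
      rw [Module.End.mul_apply, ← Int.cast_natCast, Module.End.intCast_apply, hM]
      rfl
    rw [show D + 1 = ρ σ from sub_add_cancel _ _, ← map_pow, ← hG, pow_card_eq_one', map_one, hG,
      one_pow, mul_assoc, mul_assoc, hℓ0, add_zero, right_eq_add] at hr
    exact hr
  have hsurj' : Function.Surjective (D ^ ℓ) := by
    rw [Module.End.coe_pow]
    exact hsurj.iterate ℓ
  refine subsingleton_of_forall_eq 0 fun x => ?_
  obtain ⟨y, rfl⟩ := hsurj' x
  rw [hD]
  rfl

/-- The vanishing of `k_{n+1}` passes to extensions of degree `ℓ`. -/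
lemma IsSpecialField.subsingleton_of_finrank_eq {ℓ : ℕ} (hℓ : ℓ.Prime) {K L : Type u} [Field K]
    [Field L] [Algebra K L] (hK : IsSpecialField ℓ K) (hKL : Module.finrank K L = ℓ) {n : ℕ}
    (hn : n ≠ 0) (h0 : Subsingleton (MilnorKMod ℓ K (n + 1)))
    (hex : ∀ (K' L' : Type u) [Field K'] [Field L'] [Algebra K K'] [Algebra K' L'],
      FiniteDimensional K K' → Module.finrank K' L' = ℓ → FourTermExact ℓ n K' L') :
    Subsingleton (MilnorKMod ℓ L (n + 1)) := by
  have := IsSpecialField.finiteDimensional_of_finrank_eq hℓ hKL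
  have := hK.isGalois_of_finrank_eq hℓ hKL
  refine Representation.subsingleton_of_coinvariants hℓ (smul_eq_zero ℓ)
    (by rw [IsGalois.card_aut_eq_finrank, hKL]) (galoisRep ℓ (n + 1) K L) fun x => ?_
  have h1 := mk_unitMul_unitIncl_eq_zero hℓ hK hKL hn h0 hex
  suffices h : (Representation.Coinvariants.mk
      (galoisRep ℓ (n + 1) K L)).toAddMonoidHom.toIntLinearMap = 0 from LinearMap.congr_fun h x
  refine hK.hom_ext_of_finrank_eq hℓ hKL n.succ_ne_zero fun a j b => ?_
  change Representation.Coinvariants.mk (galoisRep ℓ (n + 1) K L) _ = 0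
  induction j using Fin.cases with
  | zero =>
    -- If the nonconstant entry comes first, `n ≥ 1` provides a constant second entry to swap with
    -- it.
    obtain ⟨m, rfl⟩ := Nat.exists_eq_succ_of_ne_zero hn
    have : (Function.update (fun i => unitIncl K L (a i)) 0 b) =
        Fin.cons b (Fin.cons (unitIncl K L (a 1)) fun i => unitIncl K L (a i.succ.succ) :
          Fin (m + 1) → Lˣ) := by
      rw [Fin.update_zero_eq_cons]
      refine congrArg (Fin.cons (α := fun _ => Lˣ) b) (funext fun i => ?_)
      refine Fin.cases ?_ (fun _ => ?_) i <;> rfl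
    rw [this, ← unitMul_symbol, ← unitMul_symbol, unitMul_anticomm, ← map_neg]
    exact h1 _ _
  | succ j =>
    rw [Fin.update_succ_eq_cons, ← unitMul_symbol]
    exact h1 _ _

lemma subsingleton_of_ringEquiv {ℓ n : ℕ} {F F' : Type u} [Field F] [Field F'] (e : F ≃+* F')
    (h : Subsingleton (MilnorKMod ℓ F n)) : Subsingleton (MilnorKMod ℓ F' n) := by
  have h1 : map ℓ n (e : F →+* F') ∘ₗ map ℓ n (e.symm : F' →+* F) = LinearMap.id := by
    refine hom_ext fun a => ?_
    rw [LinearMap.comp_apply, map_symbol, map_symbol]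
    exact congrArg (symbol ℓ) (funext fun i => Units.ext (e.apply_symm_apply _))
  refine subsingleton_of_forall_eq 0 fun x => ?_
  rw [← LinearMap.id_apply (R := ℤ) x, ← h1, LinearMap.comp_apply,
    Subsingleton.elim (map ℓ n _ x) 0, map_zero]

-- In the `ℓ`-group `Gal(N/F)`, the proper subgroup fixing `K` lies in a subgroup `ℓ` times as
-- large; its fixed field is the required `M`.
open IntermediateField in
lemma IsSpecialField.exists_finrank_inclusion_eq {ℓ : ℕ} (hℓ : ℓ.Prime) {F N : Type u} [Field F]
    [Field N] [Algebra F N] [FiniteDimensional F N] [IsGalois F N] (hF : IsSpecialField ℓ F)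
    (K : IntermediateField F N) {k : ℕ} (hk : Module.finrank F K = ℓ ^ (k + 1)) :
    ∃ (M : IntermediateField F N) (hM : M ≤ K), Module.finrank F M = ℓ ^ k ∧
      letI := (inclusion hM).toRingHom.toAlgebra
      Module.finrank M K = ℓ := by
  have := Fact.mk hℓ
  obtain ⟨r, hr⟩ := hF.exists_card_aut_eq_pow hℓ N
  obtain ⟨s, hs⟩ : ∃ s, Nat.card K.fixingSubgroup = ℓ ^ s := by
    obtain ⟨s, -, hs⟩ := (Nat.dvd_prime_pow hℓ).1 (hr ▸ K.fixingSubgroup.card_subgroup_dvd_card)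
    exact ⟨s, hs⟩
  have hidx := K.fixingSubgroup.card_mul_index
  rw [← finrank_eq_fixingSubgroup_index, hk, hs, hr] at hidx
  obtain ⟨H, hH, hle⟩ := Sylow.exists_subgroup_card_pow_succ (G := Gal(N/F)) (p := ℓ) (n := s)
    (by
        rw [hr, ← hidx, pow_succ, pow_succ, mul_comm (ℓ ^ k), ← mul_assoc]
        exact dvd_mul_right _ _) hs
  have hM : fixedField H ≤ K := by
    rw [← IsGalois.fixedField_fixingSubgroup K]
    exact fixedField_antitone hle
  have hfin : Module.finrank F (fixedField H) = ℓ ^ k := by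
    have h1 := H.card_mul_index
    rw [hH, hr, ← hidx, pow_succ' ℓ k, ← mul_assoc, ← pow_succ] at h1
    rw [finrank_eq_fixingSubgroup_index, fixingSubgroup_fixedField]
    exact Nat.eq_of_mul_eq_mul_left (pow_pos hℓ.pos _) h1
  refine ⟨fixedField H, hM, hfin, ?_⟩
  let _ := (inclusion hM).toRingHom.toAlgebra
  have : IsScalarTower F (fixedField H) K := IsScalarTower.of_algebraMap_eq' rfl
  have h2 := Module.finrank_mul_finrank F (fixedField H) K
  rw [hfin, hk, pow_succ] at h2
  exact Nat.eq_of_mul_eq_mul_left (pow_pos hℓ.pos _) h2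

open IntermediateField in
lemma IsSpecialField.subsingleton_intermediateField {ℓ : ℕ} (hℓ : ℓ.Prime) {F N : Type u} [Field F]
    [Field N] [Algebra F N] [FiniteDimensional F N] [IsGalois F N] (hF : IsSpecialField ℓ F)
    {n : ℕ} (hn : n ≠ 0) (h0 : Subsingleton (MilnorKMod ℓ F (n + 1)))
    (hex : ∀ (K L : Type u) [Field K] [Field L] [Algebra F K] [Algebra K L],
      FiniteDimensional F K → Module.finrank K L = ℓ → FourTermExact ℓ n K L)
    (K : IntermediateField F N) : Subsingleton (MilnorKMod ℓ K (n + 1)) := by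
  obtain ⟨k, hk⟩ := hF.exists_finrank_eq_pow hℓ K
  induction k generalizing K with
  | zero =>
    rw [pow_zero, IntermediateField.finrank_eq_one_iff] at hk
    subst hk
    exact subsingleton_of_ringEquiv (botEquiv F N).symm.toRingEquiv h0
  | succ k ih =>
    obtain ⟨M, hM, hfin, hMK⟩ := hF.exists_finrank_inclusion_eq hℓ K hk
    let _ := (inclusion hM).toRingHom.toAlgebra
    refine (hF.of_finite hℓ M).subsingleton_of_finrank_eq hℓ hMK hn (ih M hfin) ?_
    intro K' L' _ _ _ _ _ hKL
    -- Extensions finite over `M` are finite over `F`, so the exactness hypothesis passes to `M`.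
    algebraize [(algebraMap M K').comp (algebraMap F M)]
    exact hex K' L' (FiniteDimensional.trans F M K') hKL

end MilnorKMod

end

theorem corollary4 (ℓ : ℕ) (hℓ : ℓ.Prime) (n : ℕ) (hn : 1 ≤ n)
    (F : Type u) [Field F] (hchar : ringChar F ≠ ℓ)
    (hF : ∀ (E : Type u) [Field E] [Algebra F E], FiniteDimensional F E →
      (Module.finrank F E).Coprime ℓ → Module.finrank F E = 1)
    (hexact : ∀ (K L : Type u) [Field K] [Field L] [Algebra F K] [Algebra K L],
      FiniteDimensional F K → Module.finrank K L = ℓ → MilnorKMod.FourTermExact ℓ n K L)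
    (hzero : Subsingleton (MilnorKMod ℓ F (n + 1)))
    (E : Type u) [Field E] [Algebra F E] [FiniteDimensional F E] :
    Subsingleton (MilnorKMod ℓ E (n + 1)) := by
  have hS : MilnorKMod.IsSpecialField ℓ F := ⟨hchar, hF⟩
  -- Perfectness makes the normal closure Galois over `F`; `E` is then replaced by its image there.
  have := hS.perfectField hℓ
  let N := IntermediateField.normalClosure F E (AlgebraicClosure E)
  have hN : Normal F N := inferInstance
  have : IsGalois F N := {}
  exact MilnorKMod.subsingleton_of_ringEquiv
    (AlgEquiv.ofInjectiveField (IsScalarTower.toAlgHom F E N)).symm.toRingEquiv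
    (hS.subsingleton_intermediateField hℓ (Nat.one_le_iff_ne_zero.1 hn) hzero hexact
      (IsScalarTower.toAlgHom F E N).fieldRange)
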